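/- A stabilizer ZX-diagram is a finite open graph, considered up to topology (nodes may be moved, wires bent, stretched and subdivided, and only which ends are joined matters; node-free loops are allowed), whose nodes are: green and red nodes with any finite number of legs (possibly zero) and a phase in $\{0,\pi/2,\pi,-\pi/2\}$, and Hadamard nodes with exactly two legs. Diagrams of the scaled calculus may also contain star nodes, which have no legs. A diagram is a scalar diagram if it has no inputs and no outputs, i.e. no open wires. Write $\langle\alpha|\beta\rangle$ for the scalar diagram consisting of a one-legged green node of phase $\alpha$ and a one-legged red node of phase $\beta$ joined by a wire, and $g=\langle 0|0\rangle$. Rewriting means applying finitely many of the following rules, in either direction and to arbitrary subdiagrams; each rule is also used with the colours green and red exchanged. Rules of both calculi: (spider) two nodes of the same colour joined by a wire merge and their phases add modulo $2\pi$; (loop) a wire from a green or red node to itself may be removed; (cup) a phase-$0$ node with two legs is a plain wire; (colour change) a node equals the node of the other colour with the same phase and number of legs, with a Hadamard node on each leg; ($\pi$-copy) a red node of phase $\pi$ with two legs, placed on one leg of a green phase-$0$ node, may be replaced by such red $\pi$-nodes on all the other legs. Further rules of the scalar-free calculus, with $L\to R$ written for replacing $L$ by $R$: (bialgebra) $L$: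 two three-legged green and two three-legged red nodes, all of phase $0$, each having one open leg and each green node being joined to each red node by one wire; $R$: a three-legged red phase-$0$ node joined by one wire to a three-legged green phase-$0$ node, where the red node carries the two open wires formerly at the green nodes and the green node carries the two formerly at the red nodes; (copy) $L$: a one-legged red phase-$0$ node joined to a three-legged green phase-$0$ node; $R$: two separate one-legged red phase-$0$ nodes; ($\pi$-commutation) $L$: on a wire, a red $\pi$-node followed by a green $\alpha$-node; $R$: on that wire, a green $(-\alpha)$-node followed by a red $\pi$-node; (Euler) $L$: a Hadamard node; $R$: on that wire, a green, a red and a green node, each of phase $\pi/2$. The scalar-free calculus is taken here without the convention that non-zero scalars may be dropped, so that the scalars produced are kept. In the scaled calculus these four rules are replaced by their scaled versions $$g\,L\to R,\qquad g\,L\to R,\qquad g\,L\to\langle\alpha|\pi\rangle\,R,\qquad g\,g\,L\to\langle-\tfrac{\pi}{2}|-\tfrac{\pi}{2}\rangle\,R$$ respectively, and the star rule is added: a star node together with a green phase-$0$ node without legs may be replaced by the empty diagram. Corollary. In the scalar-free calculus as well as in the scaled calculus, every stabilizer scalar diagram can be rewritten into a diagram that is a disjoint union of finitely many mutually disconnected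 scalar diagrams, each of which contains at most two nodes. -/

import Mathlib

namespace ZX

/-- The two calculi: the one with the scalar-free rewrite rules, and the one with the correctly
scaled rewrite rules and the additional star node. -/
inductive Calculus
  | scalarFree
  | scaled

/-- The two colours of phase-carrying nodes. -/
inductive Colour
  | green
  | red

/-- The other colour. -/
def Colour.swap : Colour → Colour
  | .green => .red
  | .red => .green

/-- The building blocks of stabilizer diagrams. Natural numbers name the points at which the ends
of building blocks are attached to each other. Only the topology matters, so that the ends of a
node are neither ordered nor divided into inputs and outputs.

* `spider c k A`: a node of colour `c` with phase `k * (π / 2)`, one leg for each member of `A`;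
* `had s(a, b)`: a Hadamard node with its two legs ending at `a` and `b`;
* `star`: the star node (scaled calculus only);
* `edge s(a, b)`: a piece of wire from `a` to `b`, which is not a node; `edge s(a, a)` is the
  node-free loop. -/
inductive Element (κ : Calculus)
  | spider (c : Colour) (phase : ZMod 4) (legs : Multiset ℕ)
  | had (ends : Sym2 ℕ)
  | star (h : κ = Calculus.scaled)
  | edge (ends : Sym2 ℕ)

namespace Element

variable {κ : Calculus}

/-- The end points of a building block, with multiplicity. -/
def points : Element κ → Multiset ℕ
  | spider _ _ A => A
  | had e => e.toMultiset
  | star _ => 0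
  | edge e => e.toMultiset

/-- Renaming of points. -/
def rename (f : ℕ → ℕ) : Element κ → Element κ
  | spider c k A => spider c k (A.map f)
  | had e => had (e.map f)
  | star h => star h
  | edge e => edge (e.map f)

/-- The number of nodes: every building block is one node, except that wires are not nodes. -/
def nodes : Element κ → ℕ
  | edge _ => 0
  | _ => 1

end Element

/-- A diagram is a finite collection of building blocks. Two ends with the same name are joined;
an end whose name occurs only once is an input or output of the diagram. -/
abbrev Diagram (κ : Calculus) := Multiset (Element κ)

namespace Diagram

variable {κ : Calculus}

/-- All end points in a diagram, with multiplicity. -/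
def points (D : Diagram κ) : Multiset ℕ := D.bind Element.points

/-- The number of nodes of a diagram. -/
def nodeCount (D : Diagram κ) : ℕ := (D.map Element.nodes).sum

/-- At most two ends meet at any point. -/
def WellFormed (D : Diagram κ) : Prop := ∀ p, D.points.count p ≤ 2

/-- A scalar diagram has neither inputs nor outputs: at every point that occurs in the diagram,
exactly two ends meet. -/
def IsScalar (D : Diagram κ) : Prop := ∀ p, D.points.count p = 0 ∨ D.points.count p = 2

/-- The diagram consists of disconnected segments (scalar diagrams with no point in common)
that contain at most two nodes each. -/
def IsDecomposed (D : Diagram κ) : Prop :=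
  ∃ segments : List (Diagram κ),
    D = segments.sum ∧
    (∀ S ∈ segments, S.IsScalar ∧ S.nodeCount ≤ 2) ∧
    segments.Pairwise (fun S T => Disjoint S.points T.points)

end Diagram

open Element

/-- The scalar diagram of two single-leg nodes of different colours, `c` with phase `j * (π / 2)`
and the other colour with phase `k * (π / 2)`, joined at the point `v`. -/
def innerProd (κ : Calculus) (c : Colour) (j k : ZMod 4) (v : ℕ) : Diagram κ :=
  {spider c j {v}, spider c.swap k {v}}

/-- The rewrite rules. Since ends are not divided into inputs and outputs, each rule stands
also for its upside-down version; the colour `c` covers the colour-swapped versions. Phases are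
multiples of `π / 2`, so that `π` is `2` and `-π / 2` is `3`. -/
inductive Rule : (κ : Calculus) → Diagram κ → Diagram κ → Prop
  /-- Two nodes of the same colour that are connected by an edge merge; the phases add. -/
  | spider (κ : Calculus) (c : Colour) (j k : ZMod 4) (x : ℕ) (A B : Multiset ℕ) :
      Rule κ {spider c j (x ::ₘ A), spider c k (x ::ₘ B)} {spider c (j + k) (A + B)}
  /-- Self-loops can be removed. -/
  | loop (κ : Calculus) (c : Colour) (j : ZMod 4) (x : ℕ) (A : Multiset ℕ) :
      Rule κ {spider c j (x ::ₘ x ::ₘ A)} {spider c j A}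
  /-- A phase-free node with two legs is a wire. -/
  | cup (κ : Calculus) (c : Colour) (a b : ℕ) :
      Rule κ {spider c 0 {a, b}} {edge s(a, b)}
  /-- Colour change: a node is the node of the other colour with a Hadamard node on each leg. -/
  | colour (κ : Calculus) (c : Colour) (j : ZMod 4) (P : Multiset (ℕ × ℕ)) :
      Rule κ {spider c j (P.map Prod.fst)}
        ({spider c.swap j (P.map Prod.snd)} + P.map (fun p => had s(p.1, p.2)))
  /-- A `π` phase shift is copied by a phase-free node of the other colour. -/
  | piCopy (κ : Calculus) (c : Colour) (a x : ℕ) (P : Multiset (ℕ × ℕ)) :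
      Rule κ {spider c.swap 2 {a, x}, spider c 0 (x ::ₘ P.map Prod.fst)}
        ({spider c 0 (a ::ₘ P.map Prod.snd)} +
          P.map (fun p => spider c.swap 2 {p.2, p.1}))
  /-- The bialgebra rule, scalar-free. -/
  | bialgebra (c : Colour) (a b p q w x y z u : ℕ) :
      Rule .scalarFree
        {spider c 0 {a, w, x}, spider c 0 {b, y, z},
          spider c.swap 0 {w, y, p}, spider c.swap 0 {x, z, q}}
        {spider c.swap 0 {a, b, u}, spider c 0 {u, p, q}}
  /-- The bialgebra rule, scaled. -/
  | bialgebraScaled (c : Colour) (a b p q w x y z u v : ℕ) :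
      Rule .scaled
        (innerProd .scaled c 0 0 v +
          {spider c 0 {a, w, x}, spider c 0 {b, y, z},
            spider c.swap 0 {w, y, p}, spider c.swap 0 {x, z, q}})
        {spider c.swap 0 {a, b, u}, spider c 0 {u, p, q}}
  /-- The copy rule, scalar-free. -/
  | copy (c : Colour) (a b x : ℕ) :
      Rule .scalarFree
        {spider c.swap 0 {x}, spider c 0 {x, a, b}}
        {spider c.swap 0 {a}, spider c.swap 0 {b}}
  /-- The copy rule, scaled. -/
  | copyScaled (c : Colour) (a b x v : ℕ) :
      Rule .scaled
        (innerProd .scaled c 0 0 v + {spider c.swap 0 {x}, spider c 0 {x, a, b}})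
        {spider c.swap 0 {a}, spider c.swap 0 {b}}
  /-- The `π`-commutation rule, scalar-free. -/
  | piComm (c : Colour) (j : ZMod 4) (a b x y : ℕ) :
      Rule .scalarFree
        {spider c.swap 2 {a, x}, spider c j {x, b}}
        {spider c (-j) {a, y}, spider c.swap 2 {y, b}}
  /-- The `π`-commutation rule, scaled. -/
  | piCommScaled (c : Colour) (j : ZMod 4) (a b x y v w : ℕ) :
      Rule .scaled
        (innerProd .scaled c 0 0 v + {spider c.swap 2 {a, x}, spider c j {x, b}})
        (innerProd .scaled c j 2 w + {spider c (-j) {a, y}, spider c.swap 2 {y, b}})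
  /-- The Euler decomposition of the Hadamard node, scalar-free. -/
  | euler (c : Colour) (a b x y : ℕ) :
      Rule .scalarFree
        {had s(a, b)}
        {spider c 1 {a, x}, spider c.swap 1 {x, y}, spider c 1 {y, b}}
  /-- The Euler decomposition of the Hadamard node, scaled. -/
  | eulerScaled (c : Colour) (a b x y v v' w : ℕ) :
      Rule .scaled
        (innerProd .scaled c 0 0 v + innerProd .scaled c 0 0 v' + {had s(a, b)})
        (innerProd .scaled c 3 3 w +
          {spider c 1 {a, x}, spider c.swap 1 {x, y}, spider c 1 {y, b}})
  /-- The star rule: the star node is the inverse of the phase-free node without legs. -/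
  | star (c : Colour) :
      Rule .scaled {star rfl, spider c 0 0} 0

/-- A single rewrite step. Well-formedness of both sides makes sure that the rest `C` of the
diagram meets the rewritten part only in inputs and outputs of the latter. -/
inductive Step (κ : Calculus) : Diagram κ → Diagram κ → Prop
  /-- A rewrite rule is applied to a subdiagram. -/
  | rule (L R C : Diagram κ) (h : Rule κ L R)
      (hL : Diagram.WellFormed (L + C)) (hR : Diagram.WellFormed (R + C)) :
      Step κ (L + C) (R + C)
  /-- Only the topology matters: a wire that continues another end is absorbed by it. -/
  | topology (a b : ℕ) (D : Diagram κ) (hb : b ∈ D.points)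
      (hD : Diagram.WellFormed ({edge s(a, b)} + D)) :
      Step κ ({edge s(a, b)} + D) (D.map (Element.rename (fun p => if p = b then a else p)))

/-- `D` can be rewritten into `D'`: finitely many rewrite steps, each in either direction. -/
def Rewrites (κ : Calculus) (D D' : Diagram κ) : Prop := Relation.EqvGen (Step κ) D D'

end ZX

/-! Up to scalar factors, a scalar stabilizer diagram is a sum over bits. Phase-free green nodes are
the bits ("variables"), a phase `k` on a variable x contributes i^(kx), and a Hadamard node between
x and y contributes (-1)^(xy). The proof carries out this quadratic Gauss sum one variable at a
time, by rewriting.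

`Good` adds an arbitrary decomposed diagram beside the one under study. Every scalar that a rule
creates shares no point with the rest and moves into that decomposed part (`Good.add_segment`). In
the scaled calculus the scalars consumed by the rules come for free, since g has an inverse
(`Good.of_innerProd`). After that, both calculi obey the same derived equations.

Summing over a variable v with phase k and neighbours A turns v into a red node of phase k on A
(`GoodT.eliminate`). If k is odd, the red node is a phase -k on the parity of A. Expanding it with
i^(a⊕b) = i^a i^b (-1)^(ab) gives phases on the neighbours and Hadamard nodes between them, which is
local complementation (`GoodT.eliminate_odd`). If k is even, the red node is a linear equation
between the neighbours. It is used to solve for one of them and substitute (`GoodT.eliminate_even`,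
`GoodT.substitute`). In both cases the number of variables drops, so `GraphLike.goodT` follows by
induction.

Any diagram reaches this form by colour change and by placing a phase-free green node on every wire
(`RedHad.good_add_greens`, `good`). -/

namespace ZX

open Element

variable {κ : Calculus}

/-! ### Scalar and decomposed diagrams -/

namespace Diagram

@[simp] theorem points_zero : (0 : Diagram κ).points = 0 := rfl

@[simp] theorem points_add (D E : Diagram κ) : (D + E).points = D.points + E.points :=
  Multiset.add_bind _ _ _

@[simp] theorem points_singleton (e : Element κ) :
    Diagram.points ({e} : Diagram κ) = e.points :=
  Multiset.singleton_bind _ _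

@[simp] theorem points_insert (e : Element κ) (D : Diagram κ) :
    Diagram.points (insert e D : Diagram κ) = e.points + D.points :=
  Multiset.cons_bind _ _ _

@[simp] theorem points_cons (e : Element κ) (D : Diagram κ) :
    Diagram.points (e ::ₘ D : Diagram κ) = e.points + D.points :=
  Multiset.cons_bind _ _ _

theorem IsScalar.wellFormed {D : Diagram κ} (h : D.IsScalar) : D.WellFormed := fun p => by
  rcases h p with h | h <;> omega

theorem IsDecomposed.isScalar {D : Diagram κ} (h : D.IsDecomposed) : D.IsScalar := by
  obtain ⟨l, rfl, hl, hd⟩ := h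
  induction l with
  | nil => intro p; left; rfl
  | cons S l ih =>
    intro p
    rw [List.pairwise_cons] at hd
    have h1 := (hl S (by simp)).1 p
    have h2 := ih (fun T hT => hl T (by simp [hT])) hd.2 p
    rw [List.sum_cons, points_add, Multiset.count_add]
    by_cases hp : p ∈ S.points
    · have : Multiset.count p (Diagram.points l.sum) = 0 := by
        rw [Multiset.count_eq_zero]
        intro hp'
        have : ∀ l : List (Diagram κ), p ∈ l.sum.points → ∃ T ∈ l, p ∈ T.points := by
          intro l
          induction l with
          | nil => simp
          | cons T l ih =>
            intro h
            rw [List.sum_cons, points_add, Multiset.mem_add] at h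
            rcases h with h | h
            · exact ⟨T, by simp, h⟩
            · obtain ⟨U, hU, h⟩ := ih h
              exact ⟨U, by simp [hU], h⟩
        obtain ⟨T, hT, h⟩ := this l hp'
        exact Multiset.disjoint_left.1 (hd.1 T hT) hp h
      omega
    · rw [Multiset.count_eq_zero.2 hp]
      omega

theorem disjoint_of_isScalar {S D : Diagram κ} (hS : S.IsScalar) (h : (S + D).IsScalar) :
    Disjoint S.points D.points := by
  rw [Multiset.disjoint_left]
  intro p h1 h2
  have h3 := hS p
  have h4 := h p
  rw [points_add, Multiset.count_add] at h4
  rw [← Multiset.one_le_count_iff_mem] at h1 h2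
  omega

theorem IsDecomposed.add_segment {D S : Diagram κ} (hD : D.IsDecomposed) (hS : S.IsScalar)
    (hn : S.nodeCount ≤ 2) (h : (S + D).IsScalar) : (S + D).IsDecomposed := by
  have hd := disjoint_of_isScalar hS h
  obtain ⟨l, rfl, hl, hp⟩ := hD
  refine ⟨S :: l, by simp, ?_, ?_⟩
  · intro T hT
    rcases List.mem_cons.1 hT with rfl | hT
    · exact ⟨hS, hn⟩
    · exact hl T hT
  · rw [List.pairwise_cons]
    refine ⟨fun T hT => ?_, hp⟩
    have : T ≤ l.sum := List.single_le_sum (fun _ _ => Multiset.zero_le _) T hT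
    obtain ⟨U, hU⟩ := Multiset.le_iff_exists_add.1 this
    rw [hU, points_add, Multiset.disjoint_add_right] at hd
    exact hd.1

end Diagram

open Diagram

/-! ### Rewriting beside a decomposed diagram -/

theorem Rewrites.refl (D : Diagram κ) : Rewrites κ D D := Relation.EqvGen.refl D

theorem Rewrites.symm {D D' : Diagram κ} (h : Rewrites κ D D') : Rewrites κ D' D :=
  Relation.EqvGen.symm _ _ h

theorem Rewrites.trans {D E F : Diagram κ} (h : Rewrites κ D E) (h' : Rewrites κ E F) :
    Rewrites κ D F :=
  Relation.EqvGen.trans _ _ _ h h'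

/-- In the presence of any decomposed diagram, `D` can be rewritten into a decomposed diagram. -/
def Good (D : Diagram κ) : Prop :=
  ∀ S : Diagram κ, S.IsDecomposed → (S + D).IsScalar →
    ∃ D' : Diagram κ, Rewrites κ (S + D) D' ∧ D'.IsDecomposed

theorem Good.zero : Good (0 : Diagram κ) := fun S hS _ => ⟨S, by simpa using Rewrites.refl S, hS⟩

theorem Good.of_rewrites {D : Diagram κ}
    (h : ∀ S : Diagram κ, (S + D).IsScalar →
      ∃ D', Good D' ∧ (S + D').IsScalar ∧ Rewrites κ (S + D) (S + D')) : Good D := by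
  intro S hS hSD
  obtain ⟨D', hD', hs, hr⟩ := h S hSD
  obtain ⟨E, hE, hE'⟩ := hD' S hS hs
  exact ⟨E, hr.trans hE, hE'⟩

theorem Good.congr {D D' : Diagram κ} (h : Good D') (e : D = D') : Good D := e ▸ h

/-- A scalar segment exhausts both ends at each of its points, so it is disconnected from everything
else and can join the decomposed part. This disposes of all the scalars that split off. -/
theorem Good.add_segment {S D : Diagram κ} (hS : S.IsScalar) (hn : S.nodeCount ≤ 2)
    (hD : Good D) : Good (S + D) := by
  intro T hT h
  have h2 : (S + T).IsScalar := by
    intro p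
    have h1 := hS p
    have h2 := hT.isScalar p
    have h3 := h p
    simp only [points_add, Multiset.count_add] at h3 ⊢
    omega
  have h3 : S + T + D = T + (S + D) := by abel
  rw [← h3] at h ⊢
  exact hD _ (hT.add_segment hS hn h2) h

/-! ### Fresh points and rule application -/

/-- The name of the variable that a point belongs to. -/
def var (p : ℕ) : ℕ := p.unpair.2

theorem exists_fresh (F : Finset ℕ) (v : ℕ) : ∃ x, var x = v ∧ x ∉ F := by
  by_contra! h
  have : Set.Infinite (Set.range fun i : ℕ => Nat.pair i v) := by
    apply Set.infinite_range_of_injective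
    intro i j hij
    simpa using congrArg (fun n => n.unpair.1) hij
  refine this (F.finite_toSet.subset ?_)
  rintro _ ⟨i, rfl⟩
  exact h _ (by simp [var])

/-- The well-formedness demanded by a step is a matter of counting ends. Removed internal points
lose two ends each, new ones are fresh and gain two, and the outer points keep theirs. -/
theorem rewrites_of_rule {L R C : Diagram κ} {I J : Multiset ℕ} (h : Rule κ L R ∨ Rule κ R L)
    (hP : R.points + (I + I) = L.points + (J + J)) (hJ : J.Nodup)
    (hf : ∀ p ∈ J, p ∉ (L + C).points) (hs : (L + C).IsScalar) :
    (R + C).IsScalar ∧ Rewrites κ (L + C) (R + C) := by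
  have hs' : (R + C).IsScalar := by
    intro p
    have h1 := hs p
    have h2 := congrArg (Multiset.count p) hP
    have h3 : Multiset.count p J = 0 ∨
        Multiset.count p J = 1 ∧ Multiset.count p (L + C).points = 0 := by
      by_cases hp : p ∈ J
      · exact .inr ⟨Multiset.count_eq_one_of_mem hJ hp, Multiset.count_eq_zero.2 (hf p hp)⟩
      · exact .inl (Multiset.count_eq_zero.2 hp)
    simp only [points_add, Multiset.count_add] at *
    omega
  refine ⟨hs', ?_⟩
  rcases h with h | h
  · exact Relation.EqvGen.rel _ _ (.rule L R C h hs.wellFormed hs'.wellFormed)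
  · exact Relation.EqvGen.symm _ _ (.rel _ _ (.rule R L C h hs'.wellFormed hs.wellFormed))

/-- A rewrite rule can be applied in either direction; `I` are the internal points that are
removed and `J` are the new internal points, which may be chosen outside of any finite set. -/
theorem Good.rule {L C : Diagram κ}
    (h : ∀ F : Finset ℕ, ∃ (R : Diagram κ) (I J : Multiset ℕ), (Rule κ L R ∨ Rule κ R L) ∧
      R.points + (I + I) = L.points + (J + J) ∧ J.Nodup ∧ (∀ p ∈ J, p ∉ F) ∧ Good (R + C)) :
    Good (L + C) := by
  refine .of_rewrites fun S hS => ?_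
  obtain ⟨R, I, J, hr, hP, hJ, hf, hg⟩ := h (S + (L + C)).points.toFinset
  refine ⟨_, hg, ?_⟩
  rw [add_left_comm S L, add_left_comm S R]
  refine rewrites_of_rule hr hP hJ (fun p hp => ?_) ?_
  · have := hf p hp
    rwa [Multiset.mem_toFinset, add_left_comm] at this
  · rwa [add_left_comm S L] at hS

theorem Good.rule₀ {L R C : Diagram κ} (I : Multiset ℕ) (h : Rule κ L R ∨ Rule κ R L)
    (hP : R.points + (I + I) = L.points) (hg : Good (R + C)) : Good (L + C) :=
  .rule fun _ => ⟨R, I, 0, h, by simpa using hP, by simp, by simp, hg⟩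

theorem Good.rule₁ {L C : Diagram κ} {R : ℕ → Diagram κ} (v : ℕ) (I : Multiset ℕ)
    (h : ∀ x, Rule κ L (R x) ∨ Rule κ (R x) L)
    (hP : ∀ x, (R x).points + (I + I) = L.points + ({x} + {x}))
    (hg : ∀ x, var x = v → Good (R x + C)) : Good (L + C) :=
  .rule fun F => by
    obtain ⟨x, hx, hF⟩ := exists_fresh F v
    exact ⟨R x, I, {x}, h x, hP x, by simp, by simpa using hF, hg x hx⟩

theorem Good.rule₂ {L C : Diagram κ} {R : ℕ → ℕ → Diagram κ} (v w : ℕ) (I : Multiset ℕ)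
    (h : ∀ x y, Rule κ L (R x y) ∨ Rule κ (R x y) L)
    (hP : ∀ x y, (R x y).points + (I + I) = L.points + ({x} + {x} + ({y} + {y})))
    (hg : ∀ x y, var x = v → var y = w → Good (R x y + C)) : Good (L + C) :=
  .rule fun F => by
    obtain ⟨x, hx, hF⟩ := exists_fresh F v
    obtain ⟨y, hy, hF'⟩ := exists_fresh (insert x F) w
    rw [Finset.mem_insert, not_or] at hF'
    refine ⟨R x y, I, {x, y}, h x y, ?_, by simpa using Ne.symm hF'.1, by simp [hF, hF'.2],
      hg x y hx hy⟩
    rw [hP, Multiset.insert_eq_cons, ← Multiset.singleton_add]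
    abel

@[simp] theorem points_had (a b : ℕ) : (had s(a, b) : Element κ).points = {a} + {b} := rfl

@[simp] theorem points_edge (a b : ℕ) : (edge s(a, b) : Element κ).points = {a} + {b} := rfl

@[simp] theorem points_spider (c : Colour) (k : ZMod 4) (A : Multiset ℕ) :
    (spider c k A : Element κ).points = A := rfl

/-! ### Spider, loop and cup rules -/

section rules

variable {C : Diagram κ} {c : Colour} {j k : ZMod 4} {A B : Multiset ℕ} {a b p q x y z w u : ℕ}

theorem Good.merge (x : ℕ) (h : Good ({spider c (j + k) (A + B)} + C)) :
    Good ({spider c j ({x} + A)} + {spider c k ({x} + B)} + C) :=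
  .rule₀ {x} (.inl (.spider κ c j k x A B)) (by simp [-Multiset.singleton_add]; abel) h

theorem Good.split (v : ℕ)
    (h : ∀ x, var x = v → Good ({spider c j ({x} + A)} + {spider c k ({x} + B)} + C)) :
    Good ({spider c (j + k) (A + B)} + C) :=
  .rule₁ v 0 (fun x => .inr (.spider κ c j k x A B))
    (fun x => by simp [← Multiset.singleton_add]; abel) h

theorem Good.loop (x : ℕ) (h : Good ({spider c j A} + C)) :
    Good ({spider c j ({x} + {x} + A)} + C) :=
  .rule₀ {x} (.inl (by rw [add_assoc]; exact .loop κ c j x A))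
    (by simp [-Multiset.singleton_add]; abel) h

theorem Good.cup (h : Good ({edge s(a, b)} + C)) : Good ({spider c 0 ({a} + {b})} + C) :=
  .rule₀ 0 (.inl (.cup κ c a b)) (by simp) h

theorem Good.of_edge (c : Colour) (h : Good ({spider c 0 ({a} + {b})} + C)) :
    Good ({edge s(a, b)} + C) :=
  .rule₀ 0 (.inr (.cup κ c a b)) (by simp [← Multiset.singleton_add]) h

theorem Good.recolour (c' : Colour) (h : Good ({spider c' 0 ({a} + {b})} + C)) :
    Good ({spider c 0 ({a} + {b})} + C) :=
  .cup (.of_edge c' h)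

end rules

end ZX

/-! ### Hadamard nodes, colour change and the inverse of g -/

namespace ZX

open Element Diagram

variable {κ : Calculus}

theorem Element.rename_of_forall {f : ℕ → ℕ} {e : Element κ} (h : ∀ p ∈ e.points, f p = p) :
    e.rename f = e := by
  have key : ∀ s : Sym2 ℕ, (∀ p ∈ s.toMultiset, f p = p) → s.map f = s := by
    intro s
    induction s with
    | _ a b =>
      intro h
      rw [Sym2.map_mk]
      simp only [Sym2.mem_toMultiset, Sym2.mem_iff, forall_eq_or_imp, forall_eq] at h
      simp [h.1, h.2]
  cases e with
  | spider c k A =>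
    simp only [rename]
    congr 1
    exact (Multiset.map_congr rfl h).trans (Multiset.map_id _)
  | had s => exact congrArg had (key s h)
  | star h => rfl
  | edge s => exact congrArg edge (key s h)

theorem Diagram.map_rename_of_forall {f : ℕ → ℕ} {D : Diagram κ} (h : ∀ p ∈ D.points, f p = p) :
    D.map (rename f) = D := by
  refine (Multiset.map_congr rfl fun e he => ?_).trans (Multiset.map_id _)
  exact rename_of_forall fun p hp => h p (Multiset.mem_bind.2 ⟨e, he, hp⟩)

/-- The two displayed ends already fill the point `x`, so `x` occurs nowhere else and the renaming
of the topology step changes only the Hadamard node. -/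
theorem Diagram.IsScalar.rewrites_had {a b x : ℕ} {C : Diagram κ}
    (h : ({had s(a, x)} + {edge s(b, x)} + C : Diagram κ).IsScalar) :
    Rewrites κ ({had s(a, x)} + {edge s(b, x)} + C) ({had s(a, b)} + C) := by
  have hx := h x
  simp only [points_add, points_singleton, points_had, points_edge, Multiset.count_add,
    Multiset.count_singleton, if_true] at hx
  have hxa : x ≠ a := by rintro rfl; simp at hx; omega
  have hxb : x ≠ b := by rintro rfl; simp at hx; omega
  have hxC : x ∉ C.points := by
    rw [← Multiset.count_eq_zero]; split_ifs at hx <;> omega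
  have e : ({had s(a, x)} + {edge s(b, x)} + C : Diagram κ)
      = {edge s(b, x)} + ({had s(a, x)} + C) := by abel
  have := Step.topology (κ := κ) b x ({had s(a, x)} + C)
    (by simp [points_had]) (e ▸ h).wellFormed
  rw [e]
  change Relation.EqvGen _ _ _
  convert Relation.EqvGen.rel _ _ this using 1
  rw [Multiset.map_add, Multiset.map_singleton, map_rename_of_forall]
  · simp [rename, hxa.symm]
  · intro p hp
    rw [if_neg]
    rintro rfl
    exact hxC hp

section rules

variable {C : Diagram κ} {c : Colour} {j k : ZMod 4} {A B : Multiset ℕ} {a b p q x y z w u : ℕ}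

/-- Spiders absorb a phase-free two-legged node by merging. A Hadamard node cannot, so here the node
becomes a wire and the topology step is used. -/
theorem Good.contract_had (h : Good ({had s(a, b)} + C)) :
    Good ({had s(a, x)} + {spider c 0 ({x} + {b})} + C) := by
  have h1 : Good ({had s(a, x)} + {edge s(b, x)} + C) := by
    refine .of_rewrites fun S hS => ⟨_, h, ?_⟩
    rw [add_left_comm] at hS ⊢
    rw [add_left_comm S]
    refine ⟨fun p => ?_, hS.rewrites_had⟩
    have := hS p
    simp only [points_add, points_singleton, points_had, points_edge, Multiset.count_add]
      at this ⊢
    omega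
  refine (Good.cup (c := c) (a := x) (b := b) (C := {had s(a, x)} + C) ?_).congr (by abel)
  exact h1.congr (by rw [Sym2.eq_swap (a := x)]; abel)

theorem Good.extend_had (c : Colour) (v : ℕ)
    (h : ∀ x, var x = v → Good ({had s(a, x)} + {spider c 0 ({x} + {b})} + C)) :
    Good ({had s(a, b)} + C) := by
  refine .of_rewrites fun S hS => ?_
  obtain ⟨x, hx, hF⟩ := exists_fresh (S + ({had s(a, b)} + C)).points.toFinset v
  have h1 : Good ({had s(a, x)} + {edge s(b, x)} + C) := by
    refine (Good.of_edge c (a := x) (b := b) (C := {had s(a, x)} + C) ?_).congr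
      (by rw [Sym2.eq_swap (a := x)]; abel)
    exact (h x hx).congr (by abel)
  have h2 : (S + ({had s(a, x)} + {edge s(b, x)} + C)).IsScalar := by
    intro p
    have h1 := hS p
    rw [Multiset.mem_toFinset, ← Multiset.count_eq_zero] at hF
    by_cases hp : p = x
    · subst hp
      simp only [points_add, points_singleton, points_had, points_edge, Multiset.count_add,
        Multiset.count_singleton] at hF ⊢
      split_ifs at hF ⊢ <;> omega
    · simp only [points_add, points_singleton, points_had, points_edge, Multiset.count_add,
        Multiset.count_singleton, if_neg hp] at h1 ⊢
      split_ifs at h1 ⊢ <;> omega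
  refine ⟨_, h1, h2, ?_⟩
  rw [add_left_comm] at h2 ⊢
  rw [add_left_comm S]
  exact h2.rewrites_had.symm

/-- The Hadamard nodes that join the points of each of the given pairs. -/
def hads (κ : Calculus) (P : Multiset (ℕ × ℕ)) : Diagram κ := P.map fun p => had s(p.1, p.2)

theorem hads_add (P Q : Multiset (ℕ × ℕ)) : hads κ (P + Q) = hads κ P + hads κ Q :=
  Multiset.map_add _ _ _

theorem hads_singleton (p : ℕ × ℕ) : hads κ {p} = {had s(p.1, p.2)} := rfl

theorem points_hads (P : Multiset (ℕ × ℕ)) :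
    (hads κ P).points = P.map Prod.fst + P.map Prod.snd := by
  induction P using Multiset.induction with
  | empty => rfl
  | cons p P ih =>
    rw [← Multiset.singleton_add, hads_add, points_add, ih, hads_singleton, points_singleton,
      points_had]
    simp only [Multiset.map_add, Multiset.map_singleton]
    abel

theorem exists_fresh_pairs (F : Finset ℕ) (v : ℕ) (A : Multiset ℕ) :
    ∃ P : Multiset (ℕ × ℕ), P.map Prod.fst = A ∧ (∀ p ∈ P, var p.2 = v) ∧
      (P.map Prod.snd).Nodup ∧ ∀ p ∈ P.map Prod.snd, p ∉ F := by
  induction A using Multiset.induction with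
  | empty => exact ⟨0, by simp⟩
  | cons a A ih =>
    obtain ⟨P, h1, h2, h3, h4⟩ := ih
    obtain ⟨x, hx, hF⟩ := exists_fresh (F ∪ (P.map Prod.snd).toFinset) v
    rw [Finset.mem_union, not_or, Multiset.mem_toFinset] at hF
    refine ⟨(a, x) ::ₘ P, by simp [h1], ?_, ?_, ?_⟩
    · intro p hp
      rcases Multiset.mem_cons.1 hp with rfl | hp
      exacts [hx, h2 p hp]
    · rw [Multiset.map_cons, Multiset.nodup_cons]
      exact ⟨hF.2, h3⟩
    · intro p hp
      rw [Multiset.map_cons] at hp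
      rcases Multiset.mem_cons.1 hp with rfl | hp
      exacts [hF.1, h4 p hp]

theorem Good.colour (v : ℕ)
    (h : ∀ P : Multiset (ℕ × ℕ), P.map Prod.fst = A → (∀ p ∈ P, var p.2 = v) →
      Good ({spider c.swap k (P.map Prod.snd)} + hads κ P + C)) :
    Good ({spider c k A} + C) :=
  .rule fun F => by
    obtain ⟨P, rfl, h2, h3, h4⟩ := exists_fresh_pairs F v A
    refine ⟨_, 0, P.map Prod.snd, .inl (.colour κ c k P), ?_, h3, h4, h P rfl h2⟩
    change Diagram.points (_ + hads κ P) + _ = _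
    simp only [points_add, points_hads, points_singleton, points_spider]
    abel

theorem Good.uncolour {P : Multiset (ℕ × ℕ)} (h : Good ({spider c k (P.map Prod.fst)} + C)) :
    Good ({spider c.swap k (P.map Prod.snd)} + hads κ P + C) :=
  .rule₀ (P.map Prod.snd) (.inr (.colour κ c k P)) (by
    simp only [points_add, points_hads, points_singleton, points_spider]
    abel) h

theorem innerProd_eq (v : ℕ) :
    innerProd κ c j k v = {spider c j {v}} + {spider c.swap k {v}} := rfl

theorem Good.add_innerProd {v : ℕ} (h : Good C) : Good (innerProd κ c j k v + C) := by
  refine h.add_segment (fun p => ?_) (by simp [innerProd, nodeCount, nodes])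
  simp only [innerProd_eq, points_add, points_singleton, points_spider, Multiset.count_add,
    Multiset.count_singleton]
  split_ifs <;> simp

theorem Good.add_node {e : Element κ} (he : e.points = 0) (h : Good C) : Good ({e} + C) := by
  refine h.add_segment (fun p => by simp [he]) ?_
  cases e <;> simp [nodeCount, nodes]

/-- A copy of the scalar that appears in the scaled rules can be added, because it has an
inverse. -/
theorem Good.of_innerProd (hκ : κ = .scaled) (c : Colour)
    (h : ∀ v, Good (innerProd κ c 0 0 v + C)) : Good C := by
  subst hκ
  -- The empty diagram is a star beside a legless node. That node splits into two one-legged nodes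
  -- joined at `x`, which the copy rule, read backwards with both outputs at `x`, turns into g and a
  -- second g carrying a loop. So star·g·g is empty: one g serves the hypothesis, while the other g
  -- and the star are segments.
  have h1 (y w : ℕ) : Good (innerProd .scaled c 0 0 w +
      {spider c.swap 0 {y}} + {spider c 0 {y}} + {.star rfl} + C) := by
    refine (Good.add_innerProd (c := c) (j := 0) (k := 0) (v := w)
      (.add_node (e := .star rfl) rfl (h y))).congr ?_
    rw [innerProd_eq y]
    abel
  have h2 (x : ℕ) : Good ({spider c.swap 0 {x}} + {spider c.swap 0 {x}} + ({.star rfl} + C)) := by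
    refine Good.rule₂ (R := fun y w => innerProd .scaled c 0 0 w +
      {spider c.swap 0 {y}, spider c 0 {y, x, x}})
      0 0 0 (fun y w => .inr (.copyScaled c x x y w)) (fun y w => ?_) fun y w _ _ => ?_
    · simp [innerProd_eq, ← Multiset.singleton_add]
      abel
    · refine (Good.loop (c := c) (j := 0) (A := {y}) (C := innerProd .scaled c 0 0 w +
        {spider c.swap 0 {y}} + ({.star rfl} + C)) x ?_).congr ?_
      · exact (h1 y w).congr (by abel)
      · simp only [Multiset.insert_eq_cons, ← Multiset.singleton_add]
        simp only [add_comm, add_left_comm, add_assoc]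
  have h3 : Good ({spider c.swap (0 + 0) (0 + 0)} + ({.star rfl} + C)) :=
    .split 0 fun x _ => h2 x
  refine (Good.rule₀ (L := 0) (C := C) (R := {.star rfl} + {spider c.swap 0 0}) 0
    (.inr (.star c.swap)) rfl ?_).congr (zero_add C).symm
  exact h3.congr (by rw [add_zero, add_zero]; abel)

end rules

end ZX

/-! ### The scaled rules in a form common to both calculi -/

namespace ZX

open Element Diagram

variable {κ : Calculus} {C : Diagram κ} {c : Colour} {j k l : ZMod 4} {A B : Multiset ℕ}
  {a b p q r s t x y z w u n : ℕ}

theorem Colour.swap_swap (c : Colour) : c.swap.swap = c := by cases c <;> rfl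

/-- In the scaled calculus the factor g on the left is supplied by `Good.of_innerProd`. The same
device serves the other scaled rules, and scalars on the side that is reached are discarded as
segments. -/
theorem Good.bialgebra
    (h : ∀ u, Good ({spider c.swap 0 ({a} + {b} + {u})} + {spider c 0 ({u} + {p} + {q})} + C)) :
    Good ({spider c 0 ({a} + {w} + {x})} + {spider c 0 ({b} + {y} + {z})} +
      {spider c.swap 0 ({w} + {y} + {p})} + {spider c.swap 0 ({x} + {z} + {q})} + C) := by
  cases κ with
  | scalarFree =>
    refine .rule₁ 0 {w, x, y, z} (fun u => .inl (.bialgebra c a b p q w x y z u)) (fun u => ?_)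
      fun u _ => h u
    simp [← Multiset.singleton_add]
    abel
  | scaled =>
    refine Good.of_innerProd rfl c fun v => ?_
    refine (Good.rule₁ (C := C) 0 {w, x, y, z, v}
      (fun u => .inl (.bialgebraScaled c a b p q w x y z u v)) (fun u => ?_)
      fun u _ => h u).congr ?_
    · simp [innerProd_eq, ← Multiset.singleton_add]
      abel
    · simp only [Multiset.insert_eq_cons, ← Multiset.singleton_add, add_assoc]

/-- The prescribed variables `v` and `v'` of the new wires allow the new green nodes to be merged
into existing variables later. -/
theorem Good.unbialgebra (v v' : ℕ)
    (h : ∀ w x y z, var w = v → var x = v → var y = v' → var z = v' →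
      Good ({spider c 0 ({a} + {w} + {x})} + {spider c 0 ({b} + {y} + {z})} +
        {spider c.swap 0 ({w} + {y} + {p})} + {spider c.swap 0 ({x} + {z} + {q})} + C)) :
    Good ({spider c.swap 0 ({a} + {b} + {u})} + {spider c 0 ({u} + {p} + {q})} + C) :=
  .rule fun F => by
    obtain ⟨w, hw, hwF⟩ := exists_fresh F v
    obtain ⟨x, hx, hxF⟩ := exists_fresh (insert w F) v
    obtain ⟨y, hy, hyF⟩ := exists_fresh (insert x (insert w F)) v'
    obtain ⟨z, hz, hzF⟩ := exists_fresh (insert y (insert x (insert w F))) v'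
    simp only [Finset.mem_insert, not_or] at hxF hyF hzF
    have hC := h w x y z hw hx hy hz
    cases κ with
    | scalarFree =>
      refine ⟨_, {u}, {w, x, y, z}, .inr (.bialgebra c a b p q w x y z u), ?_, ?_, ?_, hC⟩
      · simp [← Multiset.singleton_add]
        abel
      · simp; tauto
      · simp; tauto
    | scaled =>
      obtain ⟨v, -, hvF⟩ := exists_fresh (insert z (insert y (insert x (insert w F)))) 0
      simp only [Finset.mem_insert, not_or] at hvF
      refine ⟨_, {u}, {v, w, x, y, z}, .inr (.bialgebraScaled c a b p q w x y z u v), ?_, ?_, ?_,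
        (hC.add_innerProd (c := c) (j := 0) (k := 0) (v := v)).congr ?_⟩
      · simp [innerProd_eq, ← Multiset.singleton_add]
        abel
      · simp; tauto
      · simp; tauto
      · simp only [Multiset.insert_eq_cons, ← Multiset.singleton_add, add_assoc]

theorem Good.copy (h : Good ({spider c.swap 0 {a}} + {spider c.swap 0 {b}} + C)) :
    Good ({spider c.swap 0 {x}} + {spider c 0 ({x} + {a} + {b})} + C) := by
  cases κ with
  | scalarFree =>
    refine .rule₀ {x} (.inl (.copy c a b x)) ?_ h
    simp [← Multiset.singleton_add]
    abel
  | scaled =>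
    refine Good.of_innerProd rfl c fun v => ?_
    refine (Good.rule₀ (C := C) {x, v} (.inl (.copyScaled c a b x v)) ?_ h).congr ?_
    · simp [innerProd_eq, ← Multiset.singleton_add]
      abel
    · simp only [Multiset.insert_eq_cons, ← Multiset.singleton_add, add_assoc]

theorem Good.copy_swap (h : Good ({spider c 0 {a}} + {spider c 0 {b}} + C)) :
    Good ({spider c 0 {x}} + {spider c.swap 0 ({x} + {a} + {b})} + C) := by
  rw [← c.swap_swap] at h ⊢
  rw [c.swap.swap_swap]
  exact h.copy

theorem Good.pi_commute
    (h : ∀ y, Good ({spider c (-j) ({a} + {y})} + {spider c.swap 2 ({y} + {b})} + C)) :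
    Good ({spider c.swap 2 ({a} + {x})} + {spider c j ({x} + {b})} + C) := by
  cases κ with
  | scalarFree =>
    refine .rule₁ 0 {x} (fun y => .inl (.piComm c j a b x y)) (fun y => ?_) fun y _ => h y
    simp [← Multiset.singleton_add]
    abel
  | scaled =>
    refine Good.of_innerProd rfl c fun v => ?_
    refine (Good.rule₂ (C := C) 0 0 {x, v} (fun y w => .inl (.piCommScaled c j a b x y v w))
      (fun y w => ?_) fun y w _ _ =>
        ((h y).add_innerProd (c := c) (j := j) (k := 2) (v := w)).congr ?_).congr ?_
    · simp [innerProd_eq, ← Multiset.singleton_add]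
      abel
    · simp only [Multiset.insert_eq_cons, ← Multiset.singleton_add, add_assoc]
    · simp only [Multiset.insert_eq_cons, ← Multiset.singleton_add, add_assoc]

theorem Good.euler (c : Colour)
    (h : ∀ x y, Good ({spider c 1 ({a} + {x})} + {spider c.swap 1 ({x} + {y})} +
      {spider c 1 ({y} + {b})} + C)) :
    Good ({had s(a, b)} + C) := by
  cases κ with
  | scalarFree =>
    refine .rule₂ 0 0 0 (fun x y => .inl (.euler c a b x y)) (fun x y => ?_) fun x y _ _ => h x y
    simp [← Multiset.singleton_add]
    abel
  | scaled =>
    refine Good.of_innerProd rfl c fun v => Good.of_innerProd rfl c fun v' => ?_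
    refine (Good.rule (L := innerProd .scaled c 0 0 v + innerProd .scaled c 0 0 v' +
      {had s(a, b)}) (C := C) fun F => ?_).congr ?_
    · obtain ⟨x, -, hxF⟩ := exists_fresh F 0
      obtain ⟨y, -, hyF⟩ := exists_fresh (insert x F) 0
      obtain ⟨w, -, hwF⟩ := exists_fresh (insert y (insert x F)) 0
      simp only [Finset.mem_insert, not_or] at hyF hwF
      refine ⟨_, {v, v'}, {w, y, x}, .inl (.eulerScaled c a b x y v v' w), ?_, ?_, ?_,
        ((h x y).add_innerProd (c := c) (j := 3) (k := 3) (v := w)).congr ?_⟩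
      · simp [innerProd_eq, ← Multiset.singleton_add]
        abel
      · simp; tauto
      · simp; tauto
      · simp only [Multiset.insert_eq_cons, ← Multiset.singleton_add, add_assoc]
    · abel

theorem Good.pi_copy
    (h : ∀ x y, Good ({spider c 0 ({a} + {x} + {y})} + {spider c.swap 2 ({x} + {s})} +
      {spider c.swap 2 ({y} + {t})} + C)) :
    Good ({spider c.swap 2 ({a} + {r})} + {spider c 0 ({r} + {s} + {t})} + C) := by
  refine Good.rule₂ 0 0 {r} (fun x y => .inl (.piCopy κ c a r {(s, x), (t, y)}))
    (fun x y => ?_) fun x y _ _ => (h x y).congr ?_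
  · simp [← Multiset.singleton_add]
    abel
  · simp [Multiset.insert_eq_cons, ← Multiset.singleton_add, add_assoc]

end ZX

/-! ### Derived equations: Euler, Hopf and copying -/

namespace ZX

open Element Diagram

variable {κ : Calculus} {C : Diagram κ} {c c' : Colour} {j k l : ZMod 4} {A B : Multiset ℕ}
  {a b p q r s t x y z w u n : ℕ}

/-- A phase-free two-legged node is a wire in either colour, so it may take the colour of its
neighbour and merge with it. -/
theorem Good.wire (x : ℕ) (h : Good ({spider c k ({y} + A)} + C)) :
    Good ({spider c k ({x} + A)} + {spider c' 0 ({x} + {y})} + C) := by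
  refine (Good.recolour (c := c') c (a := x) (b := y) (C := {spider c k ({x} + A)} + C)
    ?_).congr (by ac_rfl)
  refine (Good.merge (c := c) (j := k) (k := 0) (A := A) (B := {y}) (C := C) x ?_).congr (by ac_rfl)
  exact h.congr (by ac_rfl)

theorem Good.unwire (c' : Colour) (v : ℕ)
    (h : ∀ x, var x = v → Good ({spider c k ({x} + A)} + {spider c' 0 ({x} + {y})} + C)) :
    Good ({spider c k ({y} + A)} + C) := by
  refine (Good.split (c := c) (j := k) (k := 0) (A := A) (B := {y}) (C := C) v fun x hx =>
    ?_).congr (by ac_rfl)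
  refine (Good.recolour (c := c) c' (a := x) (b := y) (C := {spider c k ({x} + A)} + C)
    ?_).congr (by ac_rfl)
  exact (h x hx).congr (by ac_rfl)

/-- The phase is moved to a node on a third leg. The state is then copied to both outputs, and the
copy that meets the phase is a scalar segment. -/
theorem Good.state_through (h : Good ({spider c 0 {y}} + C)) :
    Good ({spider c 0 {b}} + {spider c.swap k ({b} + {y})} + C) := by
  refine (Good.split (c := c.swap) (j := 0) (k := k) (A := {b} + {y}) (B := 0)
    (C := {spider c 0 {b}} + C) 0 fun x _ => ?_).congr (by ac_rfl)
  refine (Good.copy_swap (c := c) (x := b) (a := x) (b := y)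
    (C := {spider c.swap k {x}} + C) ?_).congr (by ac_rfl)
  exact (h.add_innerProd (c := c) (j := 0) (k := k) (v := x)).congr (by ac_rfl)

theorem exists_pair_of_map_fst {P : Multiset (ℕ × ℕ)} (h : P.map Prod.fst = {a} + A) :
    ∃ x P', P = {(a, x)} + P' ∧ P'.map Prod.fst = A := by
  rw [Multiset.singleton_add, ← Multiset.map_eq_cons] at h
  obtain ⟨⟨_, x⟩, hp, rfl, h⟩ := h
  exact ⟨x, P.erase (_, x), by rw [Multiset.singleton_add, Multiset.cons_erase hp], h⟩

theorem Good.colour_one (v : ℕ)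
    (h : ∀ x, var x = v → Good ({spider c.swap k {x}} + {had s(a, x)} + C)) :
    Good ({spider c k {a}} + C) := by
  refine .colour v fun P hP hv => ?_
  obtain ⟨x, P, rfl, hP'⟩ := exists_pair_of_map_fst (A := 0) (by rwa [add_zero])
  rw [Multiset.map_eq_zero] at hP'
  subst hP'
  exact h x (hv (a, x) (by simp))

/-- Two Hadamard nodes in a row are the colour change of a phase-free two-legged node, which is
again a wire. -/
theorem Good.had_had_cup (c : Colour) (h : Good ({spider c 0 ({p} + {r})} + C)) :
    Good ({had s(p, q)} + {had s(q, r)} + C) := by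
  refine (Good.extend_had (a := r) (b := q) (C := {had s(p, q)} + C) c.swap 0 fun x _ =>
    ?_).congr (by rw [Sym2.eq_swap (a := r)]; abel)
  refine (Good.uncolour (c := c) (k := 0) (P := {(p, q)} + {(r, x)}) (C := C) ?_).congr ?_
  · simpa using h
  · simp only [hads_add, hads_singleton, Multiset.map_add, Multiset.map_singleton]
    ac_rfl

theorem Good.had_had (q : ℕ) (h : Good ({spider c k ({r} + A)} + C)) :
    Good ({spider c k ({p} + A)} + {had s(p, q)} + {had s(q, r)} + C) := by
  refine (Good.had_had_cup (p := p) (q := q) (r := r) (C := {spider c k ({p} + A)} + C) c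
    ?_).congr (by ac_rfl)
  exact (h.wire (c' := c) p).congr (by ac_rfl)

theorem Good.cup_had_had (h : ∀ q, Good ({had s(p, q)} + {had s(q, r)} + C)) :
    Good ({spider c 0 ({p} + {r})} + C) := by
  refine .colour 0 fun P hP _ => ?_
  obtain ⟨x, P, rfl, hP⟩ := exists_pair_of_map_fst hP
  obtain ⟨y, P, rfl, hP'⟩ := exists_pair_of_map_fst (A := 0) (by rwa [add_zero])
  rw [Multiset.map_eq_zero] at hP'
  subst hP'
  refine (Good.contract_had (c := c.swap) (a := r) (x := y) (b := x) (C := {had s(p, x)} + C)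
    ?_).congr ?_
  · exact (h x).congr (by rw [Sym2.eq_swap (a := r)]; abel)
  · simp only [hads_add, hads_singleton, Multiset.map_add, Multiset.map_singleton, add_zero]
    ac_rfl

/-- Colour change puts a Hadamard node on every leg; on the leg `s` it cancels the one that was
there. -/
theorem Good.push_had (v : ℕ)
    (h : ∀ P : Multiset (ℕ × ℕ), P.map Prod.fst = A → (∀ p ∈ P, var p.2 = v) →
      Good ({spider c.swap k ({n} + P.map Prod.snd)} + hads κ P + C)) :
    Good ({spider c k ({s} + A)} + {had s(s, n)} + C) := by
  refine (Good.colour (c := c) (k := k) (A := {s} + A) (C := {had s(s, n)} + C) v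
    fun P hP hv => ?_).congr (by ac_rfl)
  obtain ⟨x, P, rfl, hP'⟩ := exists_pair_of_map_fst hP
  refine (Good.had_had (c := c.swap) (k := k) (A := P.map Prod.snd) (p := x) (q := s) (r := n)
    (C := hads κ P + C) ?_).congr ?_
  · exact (h P hP' fun p hp => hv p (Multiset.mem_add.2 (.inr hp))).congr (by ac_rfl)
  · simp only [hads_add, hads_singleton, Multiset.map_add, Multiset.map_singleton]
    rw [Sym2.eq_swap (a := x)]
    abel

theorem Good.push_had_one (v : ℕ)
    (h : ∀ y, var y = v → Good ({spider c.swap k ({n} + {y})} + {had s(x, y)} + C)) :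
    Good ({spider c k ({s} + {x})} + {had s(s, n)} + C) := by
  refine .push_had v fun P hP hv => ?_
  obtain ⟨y, P, rfl, hP'⟩ := exists_pair_of_map_fst (A := 0) (by rwa [add_zero])
  rw [Multiset.map_eq_zero] at hP'
  subst hP'
  exact h y (hv (x, y) (by simp))

/-- For `c` green: the red state 0 is a Hadamard node on the green state 0. After the Euler
decomposition of that Hadamard node, the green state absorbs the nearer red π/2, the other red π/2
cancels the phase -π/2, and the green π/2 remains. -/
theorem Good.state_three (h : Good ({spider c 1 {q}} + C)) :
    Good ({spider c.swap 3 {q}} + C) := by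
  refine (Good.split (c := c.swap) (j := 3) (k := 0) (A := {q}) (B := 0) (C := C) 0
    fun x _ => ?_).congr (by ac_rfl)
  refine (Good.colour_one (c := c.swap) (k := 0) (a := x) (C := {spider c.swap 3 ({x} + {q})} + C)
    0 fun y _ => ?_).congr (by ac_rfl)
  rw [c.swap_swap]
  refine (Good.euler (a := x) (b := y) (C := {spider c 0 {y}} + {spider c.swap 3 ({x} + {q})} + C)
    c.swap fun u v => ?_).congr (by ac_rfl)
  rw [c.swap_swap]
  refine (Good.state_through (c := c) (k := 1) (b := y) (y := v) (C := {spider c.swap 1 ({x} + {u})}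
    + {spider c 1 ({u} + {v})} + {spider c.swap 3 ({x} + {q})} + C) ?_).congr (by ac_rfl)
  refine (Good.merge (c := c) (j := 0) (k := 1) (A := 0) (B := {u})
    (C := {spider c.swap 1 ({x} + {u})} + {spider c.swap 3 ({x} + {q})} + C) v ?_).congr (by ac_rfl)
  refine (Good.merge (c := c.swap) (j := 3) (k := 1) (A := {q}) (B := {u})
    (C := {spider c 1 {u}} + C) x ?_).congr (by ac_rfl)
  refine (Good.wire (c := c) (c' := c.swap) (k := 1) (A := 0) (y := q) (C := C) u ?_).congr ?_
  · rwa [add_zero]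
  · rw [show (3 + 1 : ZMod 4) = 0 from rfl]; ac_rfl

/-- Since π/2 = π - π/2, `Good.state_three` gives the state π/2 of colour `c` behind a π-node.
Commuting past that node negates the phase, and the π-node is absorbed by a phase-free state. -/
theorem Good.state_one (h : Good ({spider c 3 {q}} + C)) :
    Good ({spider c.swap 1 {q}} + C) := by
  refine (Good.split (c := c.swap) (j := 2) (k := 3) (A := {q}) (B := 0) (C := C) 0
    fun x _ => ?_).congr (by ac_rfl)
  refine (Good.state_three (c := c) (q := x) (C := {spider c.swap 2 ({x} + {q})} + C)
    ?_).congr (by ac_rfl)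
  refine (Good.split (c := c) (j := 1) (k := 0) (A := {x}) (B := 0)
    (C := {spider c.swap 2 ({x} + {q})} + C) 0 fun b _ => ?_).congr (by ac_rfl)
  refine (Good.pi_commute (c := c) (j := 1) (a := q) (x := x) (b := b)
    (C := {spider c 0 {b}} + C) fun y => ?_).congr (by ac_rfl)
  refine (Good.state_through (c := c) (k := 2) (b := b) (y := y)
    (C := {spider c 3 ({q} + {y})} + C) ?_).congr
    (by rw [show (-1 : ZMod 4) = 3 from rfl]; ac_rfl)
  refine (Good.merge (c := c) (j := 0) (k := 3) (A := 0) (B := {q}) (C := C) y ?_).congr (by ac_rfl)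
  rwa [zero_add, zero_add]

/-- Two Hadamard nodes are inserted on the wire. The Euler decomposition of one cancels -π/2 and
leaves one node of each colour with phase π/2; the other Hadamard node changes the colour of the
second. -/
theorem Good.wire_three (v v' : ℕ) (h : ∀ u w, var u = v → var w = v' →
      Good ({spider c 1 ({x} + {u})} + {had s(u, w)} + {spider c 1 ({w} + {y})} + C)) :
    Good ({spider c.swap 3 ({x} + {y})} + C) := by
  refine (Good.split (c := c.swap) (j := 3) (k := 0) (A := {x}) (B := {y}) (C := C) 0
    fun z _ => ?_).congr (by ac_rfl)
  refine (Good.cup_had_had (c := c.swap) (p := z) (r := y)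
    (C := {spider c.swap 3 ({z} + {x})} + C) fun s => ?_).congr (by ac_rfl)
  refine (Good.euler (a := z) (b := s) (C := {had s(s, y)} + {spider c.swap 3 ({z} + {x})} + C)
    c.swap fun u w => ?_).congr (by ac_rfl)
  rw [c.swap_swap]
  refine (Good.merge (c := c.swap) (j := 3) (k := 1) (A := {x}) (B := {u})
    (C := {spider c 1 ({u} + {w})} + {spider c.swap 1 ({w} + {s})} + {had s(s, y)} + C) z
    ?_).congr (by ac_rfl)
  refine (Good.wire (c := c) (c' := c.swap) (k := 1) (A := {w}) (y := x)
    (C := {spider c.swap 1 ({w} + {s})} + {had s(s, y)} + C) u ?_).congr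
    (by rw [show (3 + 1 : ZMod 4) = 0 from rfl]; ac_rfl)
  refine (Good.push_had_one (c := c.swap) (k := 1) (s := s) (n := y) (x := w)
    (C := {spider c 1 ({x} + {w})} + C) v' fun t ht => ?_).congr (by ac_rfl)
  rw [c.swap_swap]
  refine (Good.extend_had (a := t) (b := w) (C := {spider c 1 ({y} + {t})} +
    {spider c 1 ({x} + {w})} + C) c v fun u hu => ?_).congr
    (by simp only [Sym2.eq_swap]; ac_rfl)
  refine (Good.merge (c := c) (j := 1) (k := 0) (A := {x}) (B := {u})
    (C := {had s(t, u)} + {spider c 1 ({y} + {t})} + C) w ?_).congr (by ac_rfl)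
  exact (h u t hu ht).congr (by simp only [Sym2.eq_swap]; ac_rfl)

/-- One of the two parallel wires is subdivided by a node of each colour carrying a phase-free
state, which completes the bialgebra pattern. Copying and absorbing the two states afterwards
disconnects the sides. -/
theorem Good.hopf_phaseless (h : Good ({spider c 0 {t}} + {spider c.swap 0 {s}} + C)) :
    Good ({spider c 0 ({t} + {p} + {q})} + {spider c.swap 0 ({p} + {q} + {s})} + C) := by
  refine (Good.split (c := c) (j := 0) (k := 0) (A := {t} + {q}) (B := {p})
    (C := {spider c.swap 0 ({p} + {q} + {s})} + C) 0 fun w _ => ?_).congr (by ac_rfl)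
  refine (Good.recolour (c := c) c.swap (a := w) (b := p) (C := {spider c 0 ({w} + ({t} + {q}))} +
    {spider c.swap 0 ({p} + {q} + {s})} + C) ?_).congr (by ac_rfl)
  refine (Good.split (c := c.swap) (j := 0) (k := 0) (A := {w}) (B := {p})
    (C := {spider c 0 ({w} + ({t} + {q}))} +
      {spider c.swap 0 ({p} + {q} + {s})} + C) 0 fun y _ => ?_).congr (by ac_rfl)
  refine (Good.recolour (c := c.swap) c (a := y) (b := p) (C := {spider c 0 ({w} + ({t} + {q}))} +
    {spider c.swap 0 ({y} + {w})} + {spider c.swap 0 ({p} + {q} + {s})} + C) ?_).congr (by ac_rfl)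
  refine (Good.split (c := c.swap) (j := 0) (k := 0) (A := {y} + {w}) (B := 0)
    (C := {spider c 0 ({w} + ({t} + {q}))} + {spider c 0 ({y} + {p})} +
      {spider c.swap 0 ({p} + {q} + {s})} + C) 0 fun P _ => ?_).congr (by ac_rfl)
  refine (Good.split (c := c) (j := 0) (k := 0) (A := {y} + {p}) (B := 0)
    (C := {spider c 0 ({w} + ({t} + {q}))} + {spider c.swap 0 ({P} + ({y} + {w}))} +
      {spider c.swap 0 {P}} + {spider c.swap 0 ({p} + {q} + {s})} + C) 0 fun b _ => ?_).congr (by ac_rfl)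
  refine (Good.bialgebra (c := c) (a := t) (b := b) (w := w) (x := q) (y := y) (z := p) (p := P)
    (q := s) (C := {spider c.swap 0 {P}} + {spider c 0 {b}} + C) fun u => ?_).congr (by ac_rfl)
  refine (Good.copy_swap (c := c) (x := b) (a := t) (b := u)
    (C := {spider c 0 ({u} + {P} + {s})} + {spider c.swap 0 {P}} + C) ?_).congr (by ac_rfl)
  refine (Good.merge (c := c) (j := 0) (k := 0) (A := 0) (B := {P} + {s})
    (C := {spider c 0 {t}} + {spider c.swap 0 {P}} + C) u ?_).congr (by ac_rfl)
  refine (Good.wire (c := c.swap) (c' := c) (k := 0) (A := 0) (y := s)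
    (C := {spider c 0 {t}} + C) P ?_).congr (by simp only [zero_add, add_zero]; ac_rfl)
  exact h.congr (by ac_rfl)

theorem Good.hopf (h : Good ({spider c k {t}} + {spider c.swap j A} + C)) :
    Good ({spider c k ({t} + {p} + {q})} + {spider c.swap j ({p} + {q} + A)} + C) := by
  refine (Good.split (c := c) (j := 0) (k := k) (A := {p} + {q}) (B := {t})
    (C := {spider c.swap j ({p} + {q} + A)} + C) 0 fun x _ => ?_).congr (by ac_rfl)
  refine (Good.split (c := c.swap) (j := 0) (k := j) (A := {p} + {q}) (B := A)
    (C := {spider c 0 ({x} + ({p} + {q}))} + {spider c k ({x} + {t})} + C) 0 fun y _ => ?_).congr (by ac_rfl)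
  refine (Good.hopf_phaseless (c := c) (t := x) (s := y) (p := p) (q := q)
    (C := {spider c k ({x} + {t})} + {spider c.swap j ({y} + A)} + C) ?_).congr (by ac_rfl)
  refine (Good.merge (c := c) (j := 0) (k := k) (A := 0) (B := {t})
    (C := {spider c.swap 0 {y}} + {spider c.swap j ({y} + A)} + C) x ?_).congr (by ac_rfl)
  refine (Good.merge (c := c.swap) (j := 0) (k := j) (A := 0) (B := A)
    (C := {spider c k {t}} + C) y ?_).congr (by ac_rfl)
  exact h.congr (by ac_rfl)

/-- In the Euler decomposition the two outer π/2 merge into the node, giving π. The middle node is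
then doubly connected to it and falls off by the Hopf law. -/
theorem Good.self_had (h : Good ({spider c 2 {t}} + C)) :
    Good ({spider c 0 ({t} + {p} + {q})} + {had s(p, q)} + C) := by
  refine (Good.euler (a := p) (b := q) (C := {spider c 0 ({t} + {p} + {q})} + C)
    c fun u v => ?_).congr (by ac_rfl)
  refine (Good.merge (c := c) (j := 0) (k := 1) (A := {t} + {q}) (B := {u})
    (C := {spider c.swap 1 ({u} + {v})} + {spider c 1 ({v} + {q})} + C) p ?_).congr (by ac_rfl)
  refine (Good.merge (c := c) (j := 1) (k := 1) (A := {t} + {u}) (B := {v})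
    (C := {spider c.swap 1 ({u} + {v})} + C) q ?_).congr (by ac_rfl)
  refine (Good.hopf (c := c) (k := 1 + 1) (j := 1) (p := u) (q := v) (A := 0) (t := t) (C := C)
    ?_).congr (by ac_rfl)
  exact (Good.add_node (e := spider c.swap 1 0) rfl h).congr
    (by rw [show (1 + 1 : ZMod 4) = 2 from rfl]; ac_rfl)

/-- For phase π, the π-node is first copied through the phase-free node and the remaining phase-free
state is copied after it. -/
theorem Good.copy_even (hk : k = 0 ∨ k = 2)
    (h : Good ({spider c.swap k {s}} + {spider c.swap k {t}} + C)) :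
    Good ({spider c.swap k {r}} + {spider c 0 ({r} + {s} + {t})} + C) := by
  rcases hk with rfl | rfl
  · exact h.copy
  refine (Good.split (c := c.swap) (j := 2) (k := 0) (A := {r}) (B := 0)
    (C := {spider c 0 ({r} + {s} + {t})} + C) 0 fun a _ => ?_).congr (by ac_rfl)
  refine (Good.pi_copy (c := c) (a := a) (r := r) (s := s) (t := t)
    (C := {spider c.swap 0 {a}} + C) fun x y => ?_).congr (by ac_rfl)
  refine (Good.copy (c := c) (x := a) (a := x) (b := y) (C := {spider c.swap 2 ({x} + {s})} +
    {spider c.swap 2 ({y} + {t})} + C) ?_).congr (by ac_rfl)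
  refine (Good.merge (c := c.swap) (j := 0) (k := 2) (A := 0) (B := {s})
    (C := {spider c.swap 0 {y}} + {spider c.swap 2 ({y} + {t})} + C) x ?_).congr (by ac_rfl)
  refine (Good.merge (c := c.swap) (j := 0) (k := 2) (A := 0) (B := {t})
    (C := {spider c.swap 2 {s}} + C) y ?_).congr (by ac_rfl)
  exact h.congr (by ac_rfl)

end ZX

/-! ### Diagrams over variables -/

namespace ZX

open Element Diagram

variable {κ : Calculus}

theorem exists_of_map_eq_singleton_add {α β : Type*} {f : α → β} {s : Multiset α} {b : β}
    {t : Multiset β} (h : s.map f = {b} + t) :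
    ∃ a s', s = {a} + s' ∧ f a = b ∧ s'.map f = t := by
  classical
  rw [Multiset.singleton_add, ← Multiset.map_eq_cons] at h
  obtain ⟨a, ha, hb, h⟩ := h
  exact ⟨a, s.erase a, by rw [Multiset.singleton_add, Multiset.cons_erase ha], hb, h⟩

theorem exists_of_map_eq_singleton {α β : Type*} {f : α → β} {s : Multiset α} {b : β}
    (h : s.map f = {b}) : ∃ a, s = {a} ∧ f a = b := by
  obtain ⟨a, rfl, h⟩ := Multiset.map_eq_singleton.1 h
  exact ⟨a, rfl, by simpa using h⟩

theorem Element.points_rename (f : ℕ → ℕ) (e : Element κ) :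
    (e.rename f).points = e.points.map f := by
  have key : ∀ s : Sym2 ℕ, (s.map f).toMultiset = s.toMultiset.map f := fun s => by
    induction s with
    | _ a b => rfl
  cases e with
  | spider c k A => rfl
  | had s => exact key s
  | star h => rfl
  | edge s => exact key s

theorem Diagram.points_map_rename (f : ℕ → ℕ) (D : Diagram κ) :
    Diagram.points (D.map (rename f)) = D.points.map f := by
  induction D using Multiset.induction with
  | empty => rfl
  | cons e D ih =>
    rw [Multiset.map_cons, points_cons, points_cons, ih, points_rename, Multiset.map_add]

theorem Element.eq_spider_of_rename {f : ℕ → ℕ} {e : Element κ} {c : Colour} {k : ZMod 4}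
    {A : Multiset ℕ} (h : e.rename f = spider c k A) :
    ∃ P, e = spider c k P ∧ P.map f = A := by
  cases e with
  | spider c' k' P =>
    simp only [rename, spider.injEq] at h
    obtain ⟨rfl, rfl, rfl⟩ := h
    exact ⟨P, rfl, rfl⟩
  | had s => cases h
  | star h' => cases h
  | edge s => cases h

theorem Element.eq_had_of_rename {f : ℕ → ℕ} {e : Element κ} {a b : ℕ}
    (h : e.rename f = had s(a, b)) : ∃ p q, e = had s(p, q) ∧ f p = a ∧ f q = b := by
  cases e with
  | had s =>
    induction s with
    | _ p q =>
      simp only [rename, Sym2.map_mk, had.injEq, Sym2.eq_iff] at h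
      rcases h with ⟨h1, h2⟩ | ⟨h1, h2⟩
      · exact ⟨p, q, rfl, h1, h2⟩
      · exact ⟨q, p, by rw [Sym2.eq_swap], h2, h1⟩
  | spider => cases h
  | star h' => cases h
  | edge s => cases h

/-- One phase-free green node for each variable in `V`, with a leg for each of the given points
that belongs to this variable. -/
def greens (κ : Calculus) (V : Finset ℕ) (P : Multiset ℕ) : Diagram κ :=
  V.val.map fun v => spider .green 0 (P.filter fun p => var p = v)

variable {V : Finset ℕ} {C T : Diagram κ} {P Q A N : Multiset ℕ} {p q v : ℕ} {j k : ZMod 4}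

theorem greens_congr (h : ∀ v ∈ V, (P.filter fun p => var p = v) = Q.filter fun p => var p = v) :
    greens κ V P = greens κ V Q :=
  Multiset.map_congr rfl fun v hv => by rw [h v hv]

theorem greens_add (hQ : ∀ q ∈ Q, var q ∉ V) : greens κ V (Q + P) = greens κ V P := by
  refine greens_congr fun v hv => ?_
  rw [Multiset.filter_add, Multiset.filter_eq_nil.2, zero_add]
  rintro q hq rfl
  exact hQ q hq hv

theorem greens_insert (hv : v ∉ V) :
    greens κ (insert v V) P = {spider .green 0 (P.filter fun p => var p = v)} + greens κ V P := by
  rw [greens, Finset.insert_val_of_notMem hv, Multiset.map_cons, Multiset.singleton_add]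
  rfl

theorem greens_insert_add (hv : v ∉ V) (hQ : ∀ q ∈ Q, var q = v) (hP : ∀ p ∈ P, var p ≠ v) :
    greens κ (insert v V) (Q + P) = {spider .green 0 Q} + greens κ V P := by
  rw [greens_insert hv, greens_add, Multiset.filter_add, Multiset.filter_eq_self.2 hQ,
    Multiset.filter_eq_nil.2 hP, add_zero]
  intro q hq
  rwa [hQ q hq]

theorem greens_eq (hv : v ∈ V) (hQ : ∀ q ∈ Q, var q = v) :
    greens κ V (Q + P) =
      {spider .green 0 (Q + P.filter fun p => var p = v)} + greens κ (V.erase v) P := by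
  conv_lhs => rw [← Finset.insert_erase hv]
  rw [greens_insert (Finset.notMem_erase v V), greens_add, Multiset.filter_add,
    Multiset.filter_eq_self.2 hQ]
  intro q hq
  rw [hQ q hq]
  exact Finset.notMem_erase v V

/-- `greens` reads the legs of a variable off the names of the points. Merging a node into `v` thus
only replaces the point `p` by the other legs of that node. -/
theorem Good.fuse (hv : v ∈ V) (hp : var p = v) (hQ : ∀ q ∈ Q, var q = v)
    (h : Good (greens κ V (Q + P) + C)) :
    Good ({spider .green 0 ({p} + Q)} + greens κ V ({p} + P) + C) := by
  rw [greens_eq hv hQ] at h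
  rw [greens_eq hv (by simpa using hp)]
  refine (Good.merge (c := .green) (j := 0) (k := 0) (A := Q)
    (B := P.filter fun p => var p = v) (C := greens κ (V.erase v) P + C) p ?_).congr (by ac_rfl)
  exact h.congr (by rw [add_zero, add_assoc])

theorem Good.unfuse (hv : v ∈ V) (hQ : ∀ q ∈ Q, var q = v)
    (h : ∀ x, var x = v → Good ({spider .green 0 ({x} + Q)} + greens κ V ({x} + P) + C)) :
    Good (greens κ V (Q + P) + C) := by
  rw [greens_eq hv hQ]
  refine (Good.split (c := .green) (j := 0) (k := 0) (A := Q)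
    (B := P.filter fun p => var p = v) (C := greens κ (V.erase v) P + C) v
    fun x hx => (h x hx).congr ?_).congr (by rw [add_zero, add_assoc])
  rw [greens_eq hv (by simpa using hx)]
  ac_rfl

/-- Goodness of the diagrams in which the points of `T` are variables and the variables in `V`
stand for phase-free green nodes of any arity. -/
def GoodT (V : Finset ℕ) (T : Diagram κ) : Prop :=
  ∀ E : Diagram κ, E.map (rename var) = T → Good (E + greens κ V E.points)

theorem GoodT.congr {T' : Diagram κ} (h : GoodT V T') (e : T = T') : GoodT V T := e ▸ h

theorem GoodT.zero : GoodT ∅ (0 : Diagram κ) := fun E hE => by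
  rw [Multiset.map_eq_zero.1 hE]
  exact Good.zero

theorem map_spider_add {c : Colour} {E : Diagram κ}
    (h : E.map (rename var) = {spider c k A} + T) :
    ∃ P E', E = {spider c k P} + E' ∧ P.map var = A ∧ E'.map (rename var) = T := by
  obtain ⟨e, E', rfl, he, hT⟩ := exists_of_map_eq_singleton_add h
  obtain ⟨P, rfl, hP⟩ := eq_spider_of_rename he
  exact ⟨P, E', rfl, hP, hT⟩

theorem map_phase_add {c : Colour} {E : Diagram κ}
    (h : E.map (rename var) = {spider c k {v}} + T) :
    ∃ p E', E = {spider c k {p}} + E' ∧ var p = v ∧ E'.map (rename var) = T := by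
  obtain ⟨P, E', rfl, hP, hT⟩ := map_spider_add h
  obtain ⟨p, rfl, hp⟩ := exists_of_map_eq_singleton hP
  exact ⟨p, E', rfl, hp, hT⟩

theorem map_had_add {a b : ℕ} {E : Diagram κ}
    (h : E.map (rename var) = {had s(a, b)} + T) :
    ∃ p q E', E = {had s(p, q)} + E' ∧ var p = a ∧ var q = b ∧ E'.map (rename var) = T := by
  obtain ⟨e, E', rfl, he, hT⟩ := exists_of_map_eq_singleton_add h
  obtain ⟨p, q, rfl, hp, hq⟩ := eq_had_of_rename he
  exact ⟨p, q, E', rfl, hp, hq, hT⟩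

theorem map_hads_add {E : Diagram κ}
    (h : E.map (rename var) = hads κ (A.map fun a => (a, v)) + T) :
    ∃ P E', E = hads κ P + E' ∧ (P.map Prod.fst).map var = A ∧ (∀ p ∈ P, var p.2 = v) ∧
      E'.map (rename var) = T := by
  induction A using Multiset.induction generalizing E with
  | empty => exact ⟨0, E, by simp [hads], rfl, by simp, by simpa [hads] using h⟩
  | cons a A ih =>
    rw [← Multiset.singleton_add, Multiset.map_add, hads_add, add_assoc, Multiset.map_singleton,
      hads_singleton] at h
    obtain ⟨p, q, E', rfl, hp, hq, hT⟩ := map_had_add h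
    obtain ⟨P, E'', rfl, hP, hv, hT⟩ := ih hT
    refine ⟨{(p, q)} + P, E'', by rw [hads_add, hads_singleton, add_assoc], ?_, ?_, hT⟩
    · rw [Multiset.map_add, Multiset.map_add, hP]
      simp [hp]
    · simpa [hq] using hv

theorem var_ne_of_notMem {E : Diagram κ} (hE : E.map (rename var) = T) (hv : v ∉ T.points)
    (hp : p ∈ E.points) : var p ≠ v := by
  rintro rfl
  rw [← hE, points_map_rename] at hv
  exact hv (Multiset.mem_map_of_mem _ hp)

theorem var_ne_of_map {A : Multiset ℕ} (hP : P.map var = A) (hv : v ∉ A) (hp : p ∈ P) :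
    var p ≠ v := by
  rintro rfl
  exact hv (hP ▸ Multiset.mem_map_of_mem _ hp)

theorem rename_spider (f : ℕ → ℕ) (c : Colour) (k : ZMod 4) (A : Multiset ℕ) :
    (spider c k A : Element κ).rename f = spider c k (A.map f) := rfl

theorem rename_had (f : ℕ → ℕ) (a b : ℕ) :
    (had s(a, b) : Element κ).rename f = had s(f a, f b) := rfl

end ZX

/-! ### Phases, Hadamard nodes and red nodes on variables -/

namespace ZX

open Element Diagram

variable {κ : Calculus} {V : Finset ℕ} {C T : Diagram κ} {P Q A N : Multiset ℕ}
  {p q r s v w a b c d : ℕ} {j k : ZMod 4}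

theorem GoodT.legless {c : Colour} (h : GoodT V T) : GoodT V ({spider c k 0} + T) := by
  intro E hE₀
  obtain ⟨P, E, rfl, hP, hE⟩ := map_spider_add hE₀
  obtain rfl := Multiset.map_eq_zero.1 hP
  refine (Good.add_node (e := spider c k 0) rfl (h E hE)).congr ?_
  rw [points_add, points_singleton, points_spider, zero_add, add_assoc]

theorem GoodT.merge_phases (hv : v ∈ V) (h : GoodT V ({spider .green (j + k) {v}} + T)) :
    GoodT V ({spider .green j {v}} + {spider .green k {v}} + T) := by
  intro E hE
  rw [add_assoc] at hE
  obtain ⟨p, E, rfl, hp, hE⟩ := map_phase_add hE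
  obtain ⟨q, E, rfl, hq, hE⟩ := map_phase_add hE
  refine (Good.unfuse (Q := {p} + {q}) (P := E.points)
    (C := {spider .green j {p}} + {spider .green k {q}} + E) hv (by simp [hp, hq])
    fun x hx => ?_).congr (by simp only [points_add, points_singleton, points_spider]; ac_rfl)
  refine (Good.merge (c := .green) (j := 0) (k := j) (A := {x} + {q}) (B := 0)
    (C := {spider .green k {q}} + E + greens κ V ({x} + E.points)) p ?_).congr (by ac_rfl)
  refine (Good.merge (c := .green) (j := j) (k := k) (A := {x}) (B := 0)
    (C := E + greens κ V ({x} + E.points)) q ?_).congr (by ac_rfl)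
  refine (h ({spider .green (j + k) {x}} + E) ?_).congr ?_
  · simp [rename_spider, hx, hE]
  · simp only [points_add, points_singleton, points_spider]
    ac_rfl

theorem GoodT.split_phase (hv : v ∈ V)
    (h : GoodT V ({spider .green j {v}} + {spider .green k {v}} + T)) :
    GoodT V ({spider .green (j + k) {v}} + T) := by
  intro E hE
  obtain ⟨p, E, rfl, hp, hE⟩ := map_phase_add hE
  refine (Good.split (c := .green) (j := j) (k := k) (A := 0) (B := {p})
    (C := E + greens κ V ({p} + E.points)) v fun x hx => ?_).congr
    (by simp only [points_add, points_singleton, points_spider]; ac_rfl)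
  refine (Good.split (c := .green) (j := k) (k := 0) (A := 0) (B := {x} + {p})
    (C := {spider .green j {x}} + E + greens κ V ({p} + E.points)) v fun y hy => ?_).congr
    (by ac_rfl)
  refine (Good.fuse (p := p) (Q := {x} + {y}) (P := E.points)
    (C := {spider .green j {x}} + {spider .green k {y}} + E) hv hp (by simp [hx, hy])
    ?_).congr (by ac_rfl)
  refine (h ({spider .green j {x}} + {spider .green k {y}} + E) ?_).congr ?_
  · simp [rename_spider, hx, hy, hE]
  · simp only [points_add, points_singleton, points_spider]
    ac_rfl

theorem GoodT.of_add_phase (hv : v ∈ V) (h : GoodT V ({spider .green 0 {v}} + T)) :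
    GoodT V T := by
  intro E hE
  refine (Good.unfuse (Q := 0) (P := E.points) (C := E) hv (by simp) fun x hx => ?_).congr
    (by ac_rfl)
  refine (h ({spider .green 0 {x}} + E) ?_).congr ?_
  · simp [rename_spider, hx, hE]
  · simp only [points_add, points_singleton, points_spider]
    ac_rfl

theorem GoodT.add_phase (hv : v ∈ V) (h : GoodT V T) :
    GoodT V ({spider .green 0 {v}} + T) := by
  intro E hE
  obtain ⟨p, E, rfl, hp, hE⟩ := map_phase_add hE
  refine (Good.fuse (p := p) (Q := 0) (P := E.points) (C := E) hv hp (by simp) ?_).congr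
    (by simp only [points_add, points_singleton, points_spider]; ac_rfl)
  exact (h E hE).congr (by ac_rfl)

theorem GoodT.self_had (hv : v ∈ V) (h : GoodT V ({spider .green 2 {v}} + T)) :
    GoodT V ({had s(v, v)} + T) := by
  intro E hE
  obtain ⟨p, q, E, rfl, hp, hq, hE⟩ := map_had_add hE
  refine (Good.unfuse (Q := {p} + {q}) (P := E.points) (C := {had s(p, q)} + E) hv
    (by simp [hp, hq]) fun x hx => ?_).congr
    (by simp only [points_add, points_singleton, points_had]; ac_rfl)
  refine (Good.self_had (c := .green) (t := x) (p := p) (q := q)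
    (C := E + greens κ V ({x} + E.points)) ?_).congr (by ac_rfl)
  refine (h ({spider .green 2 {x}} + E) ?_).congr ?_
  · simp [rename_spider, hx, hE]
  · simp only [points_add, points_singleton, points_spider]
    ac_rfl

/-- A variable with all its Hadamard nodes is a red node on the variables at the other ends. -/
theorem GoodT.eliminate (hV : v ∉ V) (hA : v ∉ A) (hT : v ∉ T.points)
    (h : GoodT V ({spider .red k A} + T)) :
    GoodT (insert v V) ({spider .green k {v}} + hads κ (A.map fun a => (a, v)) + T) := by
  intro E hE
  rw [add_assoc] at hE
  obtain ⟨r, E, rfl, hr, hE⟩ := map_phase_add hE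
  obtain ⟨P, E, rfl, hP, hv, hE⟩ := map_hads_add hE
  have e : greens κ (insert v V) (({r} + P.map Prod.snd) + (P.map Prod.fst + E.points)) =
      {spider .green 0 ({r} + P.map Prod.snd)} + greens κ V (P.map Prod.fst + E.points) := by
    refine greens_insert_add hV ?_ ?_
    · intro q hq
      rcases Multiset.mem_add.1 hq with hq | hq
      · rwa [Multiset.mem_singleton.1 hq]
      · obtain ⟨p, hp, rfl⟩ := Multiset.mem_map.1 hq
        exact hv p hp
    · intro q hq
      rcases Multiset.mem_add.1 hq with hq | hq
      · exact var_ne_of_map hP hA hq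
      · exact var_ne_of_notMem hE hT hq
  refine (Good.merge (c := .green) (j := 0) (k := k) (A := P.map Prod.snd) (B := 0)
    (C := hads κ P + E + greens κ V (P.map Prod.fst + E.points)) r ?_).congr ?_
  · refine (Good.uncolour (c := .red) (k := k) (P := P)
      (C := E + greens κ V (P.map Prod.fst + E.points)) ?_).congr ?_
    · refine (h ({spider .red k (P.map Prod.fst)} + E) ?_).congr ?_
      · rw [Multiset.map_add, Multiset.map_singleton, rename_spider, hP, hE]
      · simp only [points_add, points_singleton, points_spider]
        ac_rfl
    · simp only [Colour.swap, zero_add, add_zero]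
      ac_rfl
  · simp only [points_add, points_singleton, points_spider, points_hads]
    rw [show {r} + (P.map Prod.fst + P.map Prod.snd + E.points) =
      ({r} + P.map Prod.snd) + (P.map Prod.fst + E.points) by ac_rfl, e]
    simp only [add_zero]
    ac_rfl

/-- The converse of `GoodT.eliminate`: after colour change, the new green legs are named by fresh
points of the unused variable `v`. -/
theorem GoodT.introduce (hV : v ∉ V) (hA : v ∉ A) (hT : v ∉ T.points)
    (h : GoodT (insert v V) ({spider .green k {v}} + hads κ (A.map fun a => (a, v)) + T)) :
    GoodT V ({spider .red k A} + T) := by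
  intro E hE
  obtain ⟨Q, E, rfl, hQ, hE⟩ := map_spider_add hE
  rw [add_assoc]
  refine Good.colour v fun P hP hv => ?_
  refine (Good.split (c := .green) (j := k) (k := 0) (A := 0) (B := P.map Prod.snd)
    (C := hads κ P + E + greens κ V (Q + E.points)) v fun r hr => ?_).congr ?_
  · have e : greens κ (insert v V) (({r} + P.map Prod.snd) + (P.map Prod.fst + E.points)) =
        {spider .green 0 ({r} + P.map Prod.snd)} + greens κ V (P.map Prod.fst + E.points) := by
      refine greens_insert_add hV ?_ ?_
      · intro q hq
        rcases Multiset.mem_add.1 hq with hq | hq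
        · rwa [Multiset.mem_singleton.1 hq]
        · obtain ⟨p, hp, rfl⟩ := Multiset.mem_map.1 hq
          exact hv p hp
      · intro q hq
        rcases Multiset.mem_add.1 hq with hq | hq
        · exact var_ne_of_map (hP ▸ hQ) hA hq
        · exact var_ne_of_notMem hE hT hq
    refine (h ({spider .green k {r}} + hads κ P + E) ?_).congr ?_
    · simp only [Multiset.map_add, Multiset.map_singleton, rename_spider, hr, hE]
      congr 2
      rw [← hQ, ← hP, hads, hads]
      simp only [Multiset.map_map]
      refine Multiset.map_congr rfl fun p hp => ?_
      simp [rename_had, hv p hp]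
    · simp only [points_add, points_singleton, points_spider, points_hads]
      rw [show {r} + (P.map Prod.fst + P.map Prod.snd) + E.points =
        ({r} + P.map Prod.snd) + (P.map Prod.fst + E.points) by ac_rfl, e, hP]
      ac_rfl
  · simp only [points_add, points_singleton, points_spider, Colour.swap, add_zero, zero_add]
    ac_rfl

/-- The red node is split, and a phase-free green node on the connecting wire becomes the new
variable `c`, standing for the sum of `a` and `b`. -/
theorem GoodT.split_red (hV : c ∉ V) (ha : c ≠ a) (hb : c ≠ b) (hN : c ∉ N) (hT : c ∉ T.points)
    (h : GoodT (insert c V)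
      ({spider .red 0 ({a} + {b} + {c})} + {spider .red k ({c} + N)} + T)) :
    GoodT V ({spider .red k ({a} + {b} + N)} + T) := by
  intro E hE₀
  obtain ⟨Q, E, rfl, hQ, hE⟩ := map_spider_add hE₀
  rw [add_assoc] at hQ
  obtain ⟨p, Q, rfl, hp, hQ⟩ := exists_of_map_eq_singleton_add hQ
  obtain ⟨q, Q, rfl, hq, hQ⟩ := exists_of_map_eq_singleton_add hQ
  refine (Good.split (c := .red) (j := 0) (k := k) (A := {p} + {q}) (B := Q)
    (C := E + greens κ V ({p} + {q} + Q + E.points)) c fun x hx => ?_).congr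
    (by simp only [points_add, points_singleton, points_spider]; ac_rfl)
  refine (Good.unwire (c := .red) (y := x) (A := {p} + {q}) (k := 0)
    (C := {spider .red k ({x} + Q)} + E + greens κ V ({p} + {q} + Q + E.points)) .green c
      fun y hy => ?_).congr (by ac_rfl)
  have e : greens κ (insert c V) (({y} + {x}) + ({p} + {q} + Q + E.points)) =
      {spider .green 0 ({y} + {x})} + greens κ V ({p} + {q} + Q + E.points) := by
    refine greens_insert_add hV (by simp [hx, hy]) ?_
    intro r hr
    simp only [Multiset.mem_add, Multiset.mem_singleton] at hr
    rcases hr with ((rfl | rfl) | hr) | hr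
    · rw [hp]; exact ha.symm
    · rw [hq]; exact hb.symm
    · exact var_ne_of_map hQ hN hr
    · exact var_ne_of_notMem hE hT hr
  refine (h ({spider .red 0 ({p} + {q} + {y})} + {spider .red k ({x} + Q)} + E) ?_).congr ?_
  · simp only [Multiset.map_add, Multiset.map_singleton, rename_spider, hp, hq, hx, hy, hQ, hE]
  · simp only [points_add, points_singleton, points_spider]
    rw [show {p} + {q} + {y} + ({x} + Q) + E.points =
      ({y} + {x}) + ({p} + {q} + Q + E.points) by ac_rfl, e]
    ac_rfl

theorem GoodT.state_odd (hk : k = 1 ∨ k = 3) (h : GoodT V ({spider .green (-k) {a}} + T)) :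
    GoodT V ({spider .red k {a}} + T) := by
  intro E hE
  obtain ⟨p, E, rfl, hp, hE⟩ := map_phase_add hE
  have h := h ({spider .green (-k) {p}} + E) (by simp [rename_spider, hp, hE])
  simp only [points_add, points_singleton, points_spider, add_assoc] at h ⊢
  rcases hk with rfl | rfl
  · exact Good.state_one (c := .green) h
  · exact Good.state_three (c := .green) h

theorem GoodT.hopf (hw : w ∈ V)
    (h : GoodT V ({spider .red k N} + ({spider .green 0 {w}} + T))) :
    GoodT V ({spider .red k ({w} + {w} + N)} + T) := by
  intro E hE₀
  obtain ⟨Q, E, rfl, hQ, hE⟩ := map_spider_add hE₀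
  rw [add_assoc] at hQ
  obtain ⟨p, Q, rfl, hp, hQ⟩ := exists_of_map_eq_singleton_add hQ
  obtain ⟨q, Q, rfl, hq, hQ⟩ := exists_of_map_eq_singleton_add hQ
  refine (Good.unfuse (Q := {p} + {q}) (P := Q + E.points)
    (C := {spider .red k ({p} + ({q} + Q))} + E) hw
    (by simp [hp, hq]) fun x hx => ?_).congr
    (by simp only [points_add, points_singleton, points_spider]; ac_rfl)
  refine (Good.hopf (c := .green) (k := 0) (j := k) (t := x) (p := p) (q := q) (A := Q)
    (C := E + greens κ V ({x} + (Q + E.points))) ?_).congr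
    (by simp only [Colour.swap]; ac_rfl)
  refine (h ({spider .red k Q} + ({spider .green 0 {x}} + E)) ?_).congr ?_
  · simp only [Multiset.map_add, Multiset.map_singleton, rename_spider, hx, hQ, hE]
  · simp only [points_add, points_singleton, points_spider, Colour.swap]
    ac_rfl

end ZX

/-! ### Substituting a sum and copying a fixed value -/

namespace ZX

open Element Diagram

variable {κ : Calculus} {V : Finset ℕ} {C T : Diagram κ} {P Q A N : Multiset ℕ}
  {p q r s v w a b c d : ℕ} {j k : ZMod 4}

/-- If a variable is the sum of two others, then one of its legs can be replaced by the sum of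
a leg of each of the others. -/
theorem Good.distribute (ha : a ∈ V) (hb : b ∈ V) (hc : c ∈ V) (hp : var p = a) (hq : var q = b)
    (hr : var r = c) (hs : var s = c)
    (h : ∀ w x y z t, var w = a → var x = a → var y = b → var z = b → var t = c →
      Good ({spider .red 0 ({s} + ({w} + {y}))} + {spider .red 0 ({x} + {z} + {t})} +
        greens κ V ({w} + {x} + {y} + {z} + {t} + P) + C)) :
    Good ({spider .red 0 ({p} + {q} + {r})} + greens κ V ({p} + {q} + {r} + {s} + P) + C) := by
  refine (Good.unfuse (Q := {r} + {s}) (P := {p} + {q} + P)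
    (C := {spider .red 0 ({p} + {q} + {r})} + C) hc (by simp [hr, hs]) fun t ht => ?_).congr
    (by ac_rfl)
  refine (Good.unbialgebra (c := .green) (a := p) (b := q) (u := r) (p := s) (q := t)
    (C := greens κ V ({t} + ({p} + {q} + P)) + C) a b
    fun w x y z hw hx hy hz => ?_).congr (by simp only [Colour.swap]; ac_rfl)
  refine (Good.fuse (Q := {w} + {x}) (P := {t} + {q} + P)
    (C := {spider .green 0 ({q} + {y} + {z})} + {spider .red 0 ({s} + ({w} + {y}))} +
      {spider .red 0 ({x} + {z} + {t})} + C) ha hp (by simp [hw, hx]) ?_).congr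
    (by simp only [Colour.swap]; ac_rfl)
  refine (Good.fuse (Q := {y} + {z}) (P := {w} + {x} + {t} + P)
    (C := {spider .red 0 ({s} + ({w} + {y}))} +
      {spider .red 0 ({x} + {z} + {t})} + C) hb hq (by simp [hy, hz]) ?_).congr
    (by ac_rfl)
  exact (h w x y z t hw hx hy hz ht).congr (by ac_rfl)

/-- This is (-1)^((a+b)d) = (-1)^(ad) (-1)^(bd): the Hadamard node is pushed through the red node
that now carries the leg, and the resulting green node merges into `d`. -/
theorem GoodT.distribute_had (ha : a ∈ V) (hb : b ∈ V) (hc : c ∈ V) (hd : d ∈ V)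
    (h : GoodT V ({spider .red 0 ({a} + {b} + {c})} + ({had s(a, d)} + {had s(b, d)} + T))) :
    GoodT V ({spider .red 0 ({a} + {b} + {c})} + ({had s(c, d)} + T)) := by
  intro E hE₀
  obtain ⟨Q, E, rfl, hQ, hE₁⟩ := map_spider_add hE₀
  rw [add_assoc] at hQ
  obtain ⟨p, Q, rfl, hp, hQ⟩ := exists_of_map_eq_singleton_add hQ
  obtain ⟨q, Q, rfl, hq, hQ⟩ := exists_of_map_eq_singleton_add hQ
  obtain ⟨r, rfl, hr⟩ := exists_of_map_eq_singleton hQ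
  obtain ⟨s, n, E, rfl, hs, hn, hE⟩ := map_had_add hE₁
  refine (Good.distribute (P := {n} + E.points) (C := {had s(s, n)} + E) ha hb hc hp hq hr hs
    fun w x y z t hw hx hy hz ht => ?_).congr
    (by simp only [points_add, points_singleton, points_spider, points_had]; ac_rfl)
  refine (Good.push_had (c := .red) (k := 0) (A := {w} + {y})
    (C := {spider .red 0 ({x} + {z} + {t})} +
      greens κ V ({w} + {x} + {y} + {z} + {t} + ({n} + E.points)) + E) d
    fun P hP hv => ?_).congr (by abel)
  obtain ⟨w', P, rfl, hP'⟩ := exists_pair_of_map_fst hP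
  obtain ⟨y', P, rfl, hP''⟩ := exists_pair_of_map_fst (A := 0) (by rwa [add_zero])
  obtain rfl := Multiset.map_eq_zero.1 hP''
  have hw' : var w' = d := hv (w, w') (by simp)
  have hy' : var y' = d := hv (y, y') (by simp)
  refine (Good.fuse (p := n) (Q := {w'} + {y'}) (P := {w} + {x} + {y} + {z} + {t} + E.points)
    (C := {had s(w, w')} + {had s(y, y')} + {spider .red 0 ({x} + {z} + {t})} + E)
    hd hn (by simp [hw', hy']) ?_).congr ?_
  · refine (h ({spider .red 0 ({x} + {z} + {t})} + ({had s(w, w')} + {had s(y, y')} + E))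
      ?_).congr ?_
    · simp only [Multiset.map_add, Multiset.map_singleton, rename_spider, rename_had, hw, hx, hy,
        hz, ht, hw', hy', hE]
    · simp only [points_add, points_singleton, points_spider, points_had]
      ac_rfl
  · simp only [Colour.swap, hads_add, hads_singleton, Multiset.map_add, Multiset.map_singleton,
      add_zero]
    ac_rfl

/-- This is i^(a⊕b) = i^a i^b (-1)^(ab). The green state π/2 is a red state -π/2; merged with the
red node it sits on the wire between `a` and `b`, where `Good.wire_three` applies. -/
theorem GoodT.distribute_phase (ha : a ∈ V) (hb : b ∈ V) (hc : c ∈ V)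
    (h : GoodT V ({spider .red 0 ({a} + {b} + {c})} +
      ({spider .green 1 {a}} + {spider .green 1 {b}} + {had s(a, b)} + T))) :
    GoodT V ({spider .red 0 ({a} + {b} + {c})} + ({spider .green 1 {c}} + T)) := by
  intro E hE₀
  obtain ⟨Q, E, rfl, hQ, hE₁⟩ := map_spider_add hE₀
  rw [add_assoc] at hQ
  obtain ⟨p, Q, rfl, hp, hQ⟩ := exists_of_map_eq_singleton_add hQ
  obtain ⟨q, Q, rfl, hq, hQ⟩ := exists_of_map_eq_singleton_add hQ
  obtain ⟨r, rfl, hr⟩ := exists_of_map_eq_singleton hQ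
  obtain ⟨s, E, rfl, hs, hE⟩ := map_phase_add hE₁
  refine (Good.distribute (P := E.points) (C := {spider .green 1 {s}} + E) ha hb hc hp hq hr hs
    fun w x y z t hw hx hy hz ht => ?_).congr
    (by simp only [points_add, points_singleton, points_spider]; ac_rfl)
  set P := {x} + {z} + {t} + E.points with hP
  refine (Good.state_one (c := .red) (q := s) (C := {spider .red 0 ({s} + ({w} + {y}))} +
    {spider .red 0 ({x} + {z} + {t})} + greens κ V ({w} + {y} + P) + E)
    ?_).congr (by simp only [Colour.swap, hP]; ac_rfl)
  refine (Good.merge (c := .red) (j := 0) (k := 3) (A := {w} + {y}) (B := 0)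
    (C := {spider .red 0 ({x} + {z} + {t})} + greens κ V ({w} + {y} + P) + E) s
    ?_).congr (by ac_rfl)
  refine (Good.wire_three (c := .green) (x := w) (y := y)
    (C := {spider .red 0 ({x} + {z} + {t})} + greens κ V ({w} + {y} + P) + E) a b
    fun u u' hu hu' => ?_).congr (by simp only [Colour.swap]; ac_rfl)
  refine (Good.split (c := .green) (j := 1) (k := 0) (A := 0) (B := {w} + {u})
    (C := {had s(u, u')} + {spider .green 1 ({u'} + {y})} +
      ({spider .red 0 ({x} + {z} + {t})} + greens κ V ({w} + {y} + P) + E)) a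
    fun α hα => ?_).congr (by ac_rfl)
  refine (Good.fuse (p := w) (Q := {α} + {u}) (P := {y} + P)
    (C := {spider .green 1 {α}} + {had s(u, u')} + {spider .green 1 ({u'} + {y})} +
      {spider .red 0 ({x} + {z} + {t})} + E) ha hw (by simp [hα, hu]) ?_).congr (by ac_rfl)
  refine (Good.split (c := .green) (j := 1) (k := 0) (A := 0) (B := {u'} + {y})
    (C := {spider .green 1 {α}} + {had s(u, u')} + {spider .red 0 ({x} + {z} + {t})} +
      greens κ V ({α} + {u} + ({y} + P)) + E) b
    fun β hβ => ?_).congr (by ac_rfl)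
  refine (Good.fuse (p := y) (Q := {β} + {u'}) (P := {α} + {u} + P)
    (C := {spider .green 1 {α}} + {spider .green 1 {β}} + {had s(u, u')} +
      {spider .red 0 ({x} + {z} + {t})} + E) hb hy (by simp [hβ, hu']) ?_).congr (by ac_rfl)
  refine (h ({spider .red 0 ({x} + {z} + {t})} +
    ({spider .green 1 {α}} + {spider .green 1 {β}} + {had s(u, u')} + E)) ?_).congr ?_
  · simp only [Multiset.map_add, Multiset.map_singleton, rename_spider, rename_had, hx,
      hz, ht, hα, hβ, hu, hu', hE]
  · simp only [points_add, points_singleton, points_spider, points_had, hP]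
    ac_rfl

/-- With no other occurrence, `c` is a one-legged green node, which the red node copies to `a` and
`b`; the relation constrains nothing. -/
theorem GoodT.forget_sum (hV : c ∉ V) (ha : a ∈ V) (hb : b ∈ V) (hT : c ∉ T.points)
    (h : GoodT V ({spider .green 0 {a}} + {spider .green 0 {b}} + T)) :
    GoodT (insert c V) ({spider .red 0 ({a} + {b} + {c})} + T) := by
  intro E hE₀
  obtain ⟨Q, E, rfl, hQ, hE⟩ := map_spider_add hE₀
  rw [add_assoc] at hQ
  obtain ⟨p, Q, rfl, hp, hQ⟩ := exists_of_map_eq_singleton_add hQ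
  obtain ⟨q, Q, rfl, hq, hQ⟩ := exists_of_map_eq_singleton_add hQ
  obtain ⟨r, rfl, hr⟩ := exists_of_map_eq_singleton hQ
  have e : greens κ (insert c V) ({r} + ({p} + {q} + E.points)) =
      {spider .green 0 {r}} + greens κ V ({p} + {q} + E.points) := by
    refine greens_insert_add hV (by simp [hr]) ?_
    intro x hx
    simp only [Multiset.mem_add, Multiset.mem_singleton] at hx
    rcases hx with (rfl | rfl) | hx
    · rw [hp]; rintro rfl; exact hV ha
    · rw [hq]; rintro rfl; exact hV hb
    · exact var_ne_of_notMem hE hT hx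
  refine (Good.copy_swap (c := .green) (x := r) (a := p) (b := q)
    (C := E + greens κ V ({p} + {q} + E.points)) ?_).congr ?_
  · refine (h ({spider .green 0 {p}} + {spider .green 0 {q}} + E) ?_).congr ?_
    · simp only [Multiset.map_add, Multiset.map_singleton, rename_spider, hp, hq, hE]
    · simp only [points_add, points_singleton, points_spider]
      ac_rfl
  · simp only [points_add, points_singleton, points_spider, Colour.swap]
    rw [show {p} + ({q} + {r}) + E.points = {r} + ({p} + {q} + E.points) by ac_rfl, e]
    ac_rfl

theorem GoodT.copy_phase (hk : k = 0 ∨ k = 2) (hc : c ∈ V)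
    (h : GoodT V ({spider .red k {c}} + T)) :
    GoodT V ({spider .red k {c}} + ({spider .green j {c}} + T)) := by
  intro E hE
  obtain ⟨r, E, rfl, hr, hE⟩ := map_phase_add hE
  obtain ⟨s, E, rfl, hs, hE⟩ := map_phase_add hE
  refine (Good.unfuse (Q := {r} + {s}) (P := E.points)
    (C := {spider .red k {r}} + {spider .green j {s}} + E) hc (by simp [hr, hs])
    fun t ht => ?_).congr (by simp only [points_add, points_singleton, points_spider]; ac_rfl)
  refine (Good.copy_even (c := .green) (r := r) (s := s) (t := t)
    (C := {spider .green j {s}} + E + greens κ V ({t} + E.points)) hk ?_).congr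
    (by simp only [Colour.swap]; ac_rfl)
  refine (Good.add_innerProd (c := .green) (j := j) (k := k) (v := s)
    (C := {spider .red k {t}} + E + greens κ V ({t} + E.points)) ?_).congr
    (by simp only [innerProd_eq, Colour.swap]; ac_rfl)
  refine (h ({spider .red k {t}} + E) ?_).congr ?_
  · simp [rename_spider, ht, hE]
  · simp only [points_add, points_singleton, points_spider, add_comm, add_left_comm]

/-- Once the value of `c` is fixed, (-1)^(cd) is a phase 0 or π on `d`. -/
theorem GoodT.copy_had (hk : k = 0 ∨ k = 2) (hc : c ∈ V)
    (h : GoodT V ({spider .red k {c}} + ({spider .green k {d}} + T))) :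
    GoodT V ({spider .red k {c}} + ({had s(c, d)} + T)) := by
  intro E hE
  obtain ⟨r, E, rfl, hr, hE⟩ := map_phase_add hE
  obtain ⟨s, n, E, rfl, hs, hn, hE⟩ := map_had_add hE
  refine (Good.unfuse (Q := {r} + {s}) (P := {n} + E.points)
    (C := {spider .red k {r}} + {had s(s, n)} + E) hc (by simp [hr, hs])
    fun t ht => ?_).congr
    (by simp only [points_add, points_singleton, points_spider, points_had]; ac_rfl)
  refine (Good.copy_even (c := .green) (r := r) (s := s) (t := t)
    (C := {had s(s, n)} + E + greens κ V ({t} + ({n} + E.points))) hk ?_).congr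
    (by simp only [Colour.swap]; ac_rfl)
  refine (Good.push_had (c := .red) (k := k) (A := 0) (s := s) (n := n)
    (C := {spider .red k {t}} + E + greens κ V ({t} + ({n} + E.points))) 0
    fun P hP _ => ?_).congr (by simp only [Colour.swap]; ac_rfl)
  obtain rfl := Multiset.map_eq_zero.1 hP
  refine (h ({spider .red k {t}} + ({spider .green k {n}} + E)) ?_).congr ?_
  · simp [rename_spider, ht, hn, hE]
  · simp only [points_add, points_singleton, points_spider, Colour.swap, hads, Multiset.map_zero]
    ac_rfl

theorem GoodT.forget_state (hV : c ∉ V) (hT : c ∉ T.points) (h : GoodT V T) :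
    GoodT (insert c V) ({spider .red k {c}} + T) := by
  intro E hE
  obtain ⟨r, E, rfl, hr, hE⟩ := map_phase_add hE
  have e : greens κ (insert c V) ({r} + E.points) = {spider .green 0 {r}} + greens κ V E.points :=
    greens_insert_add hV (by simp [hr]) fun x hx => var_ne_of_notMem hE hT hx
  refine (Good.add_innerProd (c := .green) (j := 0) (k := k) (v := r) (h E hE)).congr ?_
  simp only [points_add, points_singleton, points_spider, Colour.swap, e, innerProd_eq]
  ac_rfl

end ZX

/-! ### Elimination of variables from graph-like diagrams -/

namespace ZX

open Element Diagram

variable {κ : Calculus} {V V' : Finset ℕ} {R T U W : Diagram κ} {A N : Multiset ℕ}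
  {v w a b c : ℕ} {k : ZMod 4}

/-- All nodes are phases of variables or Hadamard nodes between variables. -/
def GraphLike (V : Finset ℕ) (T : Diagram κ) : Prop :=
  ∀ e ∈ T, (∃ k, ∃ v ∈ V, e = spider .green k {v}) ∨ ∃ v ∈ V, ∃ w ∈ V, e = had s(v, w)

namespace GraphLike

theorem zero : GraphLike V (0 : Diagram κ) := fun _ h => absurd h (Multiset.notMem_zero _)

theorem phase (hv : v ∈ V) : GraphLike V ({spider .green k {v}} : Diagram κ) := fun _ h =>
  .inl ⟨k, v, hv, Multiset.mem_singleton.1 h⟩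

theorem had (hv : v ∈ V) (hw : w ∈ V) : GraphLike V ({had s(v, w)} : Diagram κ) := fun _ h =>
  .inr ⟨v, hv, w, hw, Multiset.mem_singleton.1 h⟩

theorem add (hT : GraphLike V T) (hU : GraphLike V U) : GraphLike V (T + U) := fun e h =>
  (Multiset.mem_add.1 h).elim (hT e) (hU e)

theorem mono (h : V ⊆ V') (hT : GraphLike V T) : GraphLike V' T := fun e he => by
  rcases hT e he with ⟨k, v, hv, rfl⟩ | ⟨v, hv, w, hw, rfl⟩
  exacts [.inl ⟨k, v, h hv, rfl⟩, .inr ⟨v, h hv, w, h hw, rfl⟩]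

theorem notMem_points (hT : GraphLike V T) (hv : v ∉ V) : v ∉ T.points := by
  intro h
  obtain ⟨e, he, h⟩ := Multiset.mem_bind.1 h
  rcases hT e he with ⟨k, w, hw, rfl⟩ | ⟨w, hw, x, hx, rfl⟩
  · simp only [points_spider, Multiset.mem_singleton] at h
    exact hv (h ▸ hw)
  · simp only [points_had, Multiset.mem_add, Multiset.mem_singleton] at h
    rcases h with rfl | rfl
    exacts [hv hw, hv hx]

/-- Every graph-like diagram can be taken apart into elements that do not involve a given
variable, phases of this variable, Hadamard nodes between this variable and another, and
Hadamard nodes from this variable to itself. -/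
theorem induction_on {motive : Diagram κ → Diagram κ → Prop}
    (zero : ∀ W, GraphLike V W → motive 0 W)
    (other : ∀ T U W, GraphLike V T → motive U (T + W) → motive (T + U) W)
    (phase : ∀ k U W, (∀ W, GraphLike V W → motive U W) → GraphLike V W →
      motive ({spider .green k {v}} + U) W)
    (had : ∀ w U W, w ∈ V → (∀ W, GraphLike V W → motive U W) → GraphLike V W →
      motive ({Element.had s(v, w)} + U) W)
    (self : ∀ U W, (∀ W, GraphLike V W → motive U W) → GraphLike V W →
      motive ({Element.had s(v, v)} + U) W)
    (hU : GraphLike (insert v V) U) (hW : GraphLike V W) : motive U W := by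
  induction U using Multiset.induction generalizing W with
  | empty => exact zero W hW
  | cons e U ih =>
    rw [← Multiset.singleton_add] at hU ⊢
    have ih' (W : Diagram κ) (hW : GraphLike V W) : motive U W :=
      ih (fun e he => hU e (Multiset.mem_add.2 (.inr he))) hW
    rcases hU e (by simp) with ⟨k, x, hx, rfl⟩ | ⟨x, hx, y, hy, rfl⟩
    · rcases Finset.mem_insert.1 hx with rfl | hx'
      · exact phase k U W (fun W hW => ih' W hW) hW
      · exact other _ U W (.phase hx') (ih' _ (.add (.phase hx') hW))
    · rcases Finset.mem_insert.1 hx with rfl | hx' <;> rcases Finset.mem_insert.1 hy with rfl | hy'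
      · exact self U W (fun W hW => ih' W hW) hW
      · exact had y U W hy' (fun W hW => ih' W hW) hW
      · rw [Sym2.eq_swap]
        exact had x U W hx' (fun W hW => ih' W hW) hW
      · exact other _ U W (.had hx' hy') (ih' _ (.add (.had hx' hy') hW))

end GraphLike

/-- The sum law is available for π/2 only, so a phase is distributed one quarter turn at a time;
what lands on `a` and `b` is collected in `U`. -/
theorem GoodT.distribute_phases (ha : a ∈ V) (hb : b ∈ V) (n : ℕ)
    (h : ∀ U, GraphLike V U →
      GoodT (insert c V) ({spider .red 0 ({a} + {b} + {c})} + (U + T))) :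
    GoodT (insert c V) ({spider .red 0 ({a} + {b} + {c})} + ({spider .green n {c}} + T)) := by
  induction n generalizing T with
  | zero =>
    refine (GoodT.add_phase (v := c) (T := {spider .red 0 ({a} + {b} + {c})} + T) (by simp)
      ?_).congr (by rw [Nat.cast_zero]; abel)
    exact (h 0 .zero).congr (by abel)
  | succ n ih =>
    refine (GoodT.split_phase (v := c) (j := n) (k := 1)
      (T := {spider .red 0 ({a} + {b} + {c})} + T) (by simp) ?_).congr
      (by rw [Nat.cast_succ]; abel)
    refine (GoodT.distribute_phase (T := {spider .green n {c}} + T) (Finset.mem_insert_of_mem ha)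
      (Finset.mem_insert_of_mem hb) (Finset.mem_insert_self c V) ?_).congr (by abel)
    refine (ih (T := {spider .green 1 {a}} + {spider .green 1 {b}} + {had s(a, b)} + T)
      fun U hU => ?_).congr (by abel)
    refine (h (U + {spider .green 1 {a}} + {spider .green 1 {b}} + {had s(a, b)})
      (((hU.add (.phase ha)).add (.phase hb)).add (.had ha hb))).congr (by abel)

/-- A variable that is the sum of two others can be eliminated. -/
theorem GoodT.substitute (hc : c ∉ V) (ha : a ∈ V) (hb : b ∈ V) (hR : c ∉ R.points)
    (hU : GraphLike (insert c V) U) (h : ∀ T, GraphLike V T → GoodT V (T + R)) :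
    GoodT (insert c V) ({spider .red 0 ({a} + {b} + {c})} + (U + R)) := by
  have ha' := Finset.mem_insert_of_mem (b := c) ha
  have hb' := Finset.mem_insert_of_mem (b := c) hb
  have hc' := Finset.mem_insert_self c V
  have hphase (k : ZMod 4) (U W : Diagram κ)
      (ih : ∀ W, GraphLike V W →
        GoodT (insert c V) ({spider .red 0 ({a} + {b} + {c})} + (U + W + R)))
      (hW : GraphLike V W) : GoodT (insert c V)
        ({spider .red 0 ({a} + {b} + {c})} + ({spider .green k {c}} + U + W + R)) := by
    refine (GoodT.distribute_phases (T := U + W + R) ha hb k.val fun S hS =>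
      (ih (S + W) (hS.add hW)).congr (by abel)).congr ?_
    rw [ZMod.natCast_val, ZMod.cast_id]
    abel
  refine GoodT.congr ?_ (T' := {spider .red 0 ({a} + {b} + {c})} + (U + 0 + R)) (by rw [add_zero])
  refine GraphLike.induction_on (v := c) (V := V) (U := U) (W := 0) (motive := fun U W =>
    GoodT (insert c V) ({spider .red 0 ({a} + {b} + {c})} + (U + W + R)))
    ?_ ?_ ?_ ?_ ?_ hU .zero
  · intro W hW
    refine (GoodT.forget_sum (T := W + R) hc ha hb ?_ ?_).congr (by rw [zero_add])
    · rw [points_add, Multiset.mem_add, not_or]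
      exact ⟨hW.notMem_points hc, hR⟩
    · exact (h _ (((GraphLike.phase ha).add (.phase hb)).add hW)).congr (by abel)
  · intro T U W _ ih
    exact ih.congr (by abel)
  · exact hphase
  · intro d U W hd ih hW
    refine (GoodT.distribute_had (T := U + W + R) ha' hb' hc' (Finset.mem_insert_of_mem hd)
      ?_).congr (by abel)
    exact (ih _ (((GraphLike.had ha hd).add (.had hb hd)).add hW)).congr (by abel)
  · intro U W ih hW
    refine (GoodT.self_had (T := {spider .red 0 ({a} + {b} + {c})} + (U + W + R)) hc' ?_).congr
      (by abel)
    exact (hphase 2 U W ih hW).congr (by abel)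

/-- A variable with a fixed value can be eliminated. -/
theorem GoodT.specialize (hk : k = 0 ∨ k = 2) (hc : c ∉ V) (hU : GraphLike (insert c V) U)
    (h : ∀ T : Diagram κ, GraphLike V T → GoodT V T) :
    GoodT (insert c V) ({spider .red k {c}} + U) := by
  have hc' := Finset.mem_insert_self c V
  refine GoodT.congr ?_ (T' := {spider .red k {c}} + (U + 0)) (by rw [add_zero])
  refine GraphLike.induction_on (v := c) (V := V) (U := U) (W := 0) (motive := fun U W =>
    GoodT (insert c V) ({spider .red k {c}} + (U + W))) ?_ ?_ ?_ ?_ ?_ hU .zero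
  · intro W hW
    exact (GoodT.forget_state hc (hW.notMem_points hc) (h W hW)).congr (by rw [zero_add])
  · intro T U W _ ih
    exact ih.congr (by abel)
  · intro j U W ih hW
    exact (GoodT.copy_phase (T := U + W) hk hc' (ih W hW)).congr (by abel)
  · intro d U W hd ih hW
    refine (GoodT.copy_had (T := U + W) hk hc' ?_).congr (by abel)
    exact (ih _ (.add (.phase hd) hW)).congr (by abel)
  · intro U W ih hW
    refine (GoodT.self_had (T := {spider .red k {c}} + (U + W)) hc' ?_).congr (by abel)
    exact (GoodT.copy_phase (T := U + W) hk hc' (ih W hW)).congr (by abel)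

/-- A red node with an odd phase can be eliminated by local complementation. -/
theorem GoodT.eliminate_odd (hk : k = 1 ∨ k = 3) (hN : ∀ a ∈ N, a ∈ V)
    (h : ∀ T, GraphLike V T → GoodT V (T + R)) : GoodT V ({spider .red k N} + R) := by
  induction hn : N.card using Nat.strong_induction_on generalizing N V R with
  | _ n ih =>
    subst hn
    induction N using Multiset.induction with
    | empty => exact GoodT.legless ((h 0 .zero).congr (zero_add R).symm)
    | cons a N _ =>
      have ha := hN a (by simp)
      induction N using Multiset.induction with
      | empty => exact GoodT.state_odd hk (h _ (.phase ha))
      | cons b N _ =>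
        have hb := hN b (by simp)
        have hN' : ∀ a ∈ N, a ∈ V := fun a ha => hN a (by simp [ha])
        obtain ⟨c, hc⟩ := Infinite.exists_notMem_finset (V ∪ R.points.toFinset)
        rw [Finset.mem_union, not_or, Multiset.mem_toFinset] at hc
        refine (GoodT.split_red (k := k) (a := a) (b := b) (N := N) hc.1 (by rintro rfl; exact hc.1 ha)
          (by rintro rfl; exact hc.1 hb) (fun h => hc.1 (hN' _ h)) hc.2 ?_).congr
          (by simp only [← Multiset.singleton_add, add_assoc])
        -- The shorter red node is eliminated with `c` as an extra variable. The result may involve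
        -- `c`, which is then replaced by the sum of `a` and `b`.
        refine (ih _ (by simp) (N := {c} + N) (V := insert c V)
          (R := {spider .red 0 ({a} + {b} + {c})} + R) ?_ (fun T hT => ?_) rfl).congr (by abel)
        · intro x hx
          rcases Multiset.mem_add.1 hx with hx | hx
          · simp [Multiset.mem_singleton.1 hx]
          · exact Finset.mem_insert_of_mem (hN' x hx)
        · exact (GoodT.substitute hc.1 ha hb hc.2 hT h).congr (by abel)

/-- A red node with an even phase can be eliminated by expressing one of its variables in terms
of the others. -/
theorem GoodT.eliminate_even (hk : k = 0 ∨ k = 2) (hN : ∀ a ∈ N, a ∈ V) (hT : GraphLike V T)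
    (h : ∀ (V' : Finset ℕ) (T : Diagram κ), V'.card ≤ V.card → GraphLike V' T → GoodT V' T) :
    GoodT V ({spider .red k N} + T) := by
  induction hn : N.card using Nat.strong_induction_on generalizing N V T with
  | _ n ih =>
    subst hn
    induction N using Multiset.induction with
    | empty => exact GoodT.legless (h V T le_rfl hT)
    | cons w N _ =>
      have hw := hN w (by simp)
      -- A variable that occurs twice cancels modulo 2, by the Hopf law. Otherwise the equation can
      -- be solved for `w`.
      by_cases hwN : w ∈ N
      · obtain ⟨N, rfl⟩ := Multiset.exists_cons_of_mem hwN
        refine (GoodT.hopf (k := k) (N := N) (T := T) hw ?_).congr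
          (by simp only [← Multiset.singleton_add, add_assoc])
        exact ih _ (by simp) (fun a ha => hN a (by simp [ha])) (.add (.phase hw) hT) h rfl
      · have hV : insert w (V.erase w) = V := Finset.insert_erase hw
        have hw' := Finset.notMem_erase w V
        induction N using Multiset.induction with
        | empty =>
          rw [← hV] at hT ⊢
          exact GoodT.specialize hk hw' hT fun T hT =>
            h _ T (Finset.card_le_card (Finset.erase_subset w V)) hT
        | cons n N _ =>
          have hn := hN n (by simp)
          rw [Multiset.mem_cons, not_or] at hwN
          have hN' : ∀ a ∈ N, a ∈ V := fun a ha => hN a (by simp [ha])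
          obtain ⟨c, hc⟩ := Infinite.exists_notMem_finset V
          have hcw : c ≠ w := by rintro rfl; exact hc hw
          -- The new variable `c` is traded for `w`, so the bound on the number of variables
          -- survives.
          have hcard : (insert c (V.erase w)).card ≤ V.card := by
            rw [Finset.card_insert_of_notMem (fun h => hc (Finset.mem_of_mem_erase h)),
              Finset.card_erase_of_mem hw]
            have := Finset.card_pos.2 ⟨w, hw⟩
            omega
          refine (GoodT.split_red (k := k) (a := w) (b := n) (N := N) hc hcw
            (by rintro rfl; exact hc hn) (fun h => hc (hN' _ h)) (hT.notMem_points hc) ?_).congr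
            (by simp only [← Multiset.singleton_add, add_assoc])
          -- The relation c = w + n is read as w = n + c, and it is `w` that is eliminated. The
          -- remaining red node has one leg less.
          rw [← hV, Finset.insert_comm]
          refine (GoodT.substitute (V := insert c (V.erase w)) (a := n) (b := c) (c := w)
            (R := {spider .red k ({c} + N)}) (U := T) ?_ ?_ (by simp) ?_ ?_ fun U hU => ?_).congr ?_
          · simp [hcw.symm]
          · simp [hn, Ne.symm hwN.1]
          · simpa [hcw.symm] using hwN.2
          · rw [Finset.insert_comm, hV]
            exact hT.mono (Finset.subset_insert c V)
          · refine (ih _ (by simp) (N := {c} + N) ?_ hU (fun V' T hV' => h V' T (hV'.trans hcard))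
              rfl).congr (by abel)
            intro x hx
            rcases Multiset.mem_add.1 hx with hx | hx
            · simp [Multiset.mem_singleton.1 hx]
            · refine Finset.mem_insert_of_mem (Finset.mem_erase.2 ⟨?_, hN' x hx⟩)
              rintro rfl
              exact hwN.2 hx
          · ac_rfl

/-- Strong induction on the number of variables is needed because the even case changes the set of
variables, not merely its size. -/
theorem GraphLike.goodT (hT : GraphLike V T) : GoodT V T := by
  induction hn : V.card using Nat.strong_induction_on generalizing V T with
  | _ n ih =>
    subst hn
    induction V using Finset.induction with
    | empty =>
      rw [Multiset.eq_zero_of_forall_notMem (s := T) fun e he => by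
        rcases hT e he with ⟨k, v, hv, -⟩ | ⟨v, hv, -⟩ <;> simp at hv]
      exact GoodT.zero
    | insert v V hv _ =>
      have hv' := Finset.mem_insert_self v V
      have ih (V' : Finset ℕ) (T : Diagram κ) (hV' : V'.card ≤ V.card) (hT : GraphLike V' T) :
          GoodT V' T :=
        ih _ (by rw [Finset.card_insert_of_notMem hv]; omega) hT rfl
      -- A phase 0 is added so that there is always a node in which the phases of `v` can be
      -- gathered.
      refine GoodT.of_add_phase hv' ?_
      -- The total phase `k` of `v` and the multiset `A` of its neighbours are generalised, so that
      -- both can grow as the elements at `v` are collected.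
      suffices ∀ (k : ZMod 4) (A : Multiset ℕ), (∀ a ∈ A, a ∈ V) → GoodT (insert v V)
          ({spider .green k {v}} + hads κ (A.map fun a => (a, v)) + (T + 0)) from
        (this 0 0 (by simp)).congr (by simp [hads])
      refine GraphLike.induction_on (v := v) (V := V) (U := T) (W := 0)
        (motive := fun T W => ∀ (k : ZMod 4) (A : Multiset ℕ), (∀ a ∈ A, a ∈ V) →
          GoodT (insert v V) ({spider .green k {v}} + hads κ (A.map fun a => (a, v)) + (T + W)))
        ?_ ?_ ?_ ?_ ?_ hT .zero
      · intro W hW k A hA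
        refine (GoodT.eliminate (T := W) hv (fun h => hv (hA _ h)) (hW.notMem_points hv)
          ?_).congr (by rw [zero_add])
        have : (k = 0 ∨ k = 2) ∨ (k = 1 ∨ k = 3) := by revert k; decide
        rcases this with hk | hk
        · exact GoodT.eliminate_even hk hA hW ih
        · exact GoodT.eliminate_odd hk hA fun T hT => ih V _ le_rfl (hT.add hW)
      · intro T U W _ h k A hA
        exact (h k A hA).congr (by abel)
      · intro j U W h hW k A hA
        refine (GoodT.merge_phases (j := k) (k := j) (T := hads κ (A.map fun a => (a, v)) + (U + W))
          hv' ?_).congr (by abel)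
        exact (h W hW _ A hA).congr (by abel)
      · intro w U W hw h hW k A hA
        refine (h W hW k ({w} + A) ?_).congr ?_
        · intro x hx
          rcases Multiset.mem_add.1 hx with hx | hx
          · rwa [Multiset.mem_singleton.1 hx]
          · exact hA x hx
        · rw [Multiset.map_add, hads_add, Multiset.map_singleton, hads_singleton, Sym2.eq_swap]
          abel
      · intro U W h hW k A hA
        refine (GoodT.self_had (T := {spider .green k {v}} +
          (hads κ (A.map fun a => (a, v)) + (U + W))) hv' ?_).congr (by abel)
        refine (GoodT.merge_phases (j := k) (k := 2)
          (T := hads κ (A.map fun a => (a, v)) + (U + W)) hv' ?_).congr (by abel)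
        exact (h W hW _ A hA).congr (by abel)

end ZX

/-! ### Reduction of arbitrary diagrams to graph-like ones -/

namespace ZX

open Element Diagram

variable {κ : Calculus} {V : Finset ℕ} {C D E T X : Diagram κ} {P : Multiset ℕ} {p v : ℕ}

/-- All nodes are red nodes or Hadamard nodes, and there are no pieces of wire. -/
def RedHad (D : Diagram κ) : Prop :=
  ∀ e ∈ D, (∃ k A, e = spider .red k A) ∨ ∃ a b, e = had s(a, b)

namespace RedHad

theorem red (k : ZMod 4) (A : Multiset ℕ) : RedHad ({spider .red k A} : Diagram κ) := fun _ h =>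
  .inl ⟨k, A, Multiset.mem_singleton.1 h⟩

theorem had (a b : ℕ) : RedHad ({had s(a, b)} : Diagram κ) := fun _ h =>
  .inr ⟨a, b, Multiset.mem_singleton.1 h⟩

theorem hads (P : Multiset (ℕ × ℕ)) : RedHad (hads κ P) := fun _ h => by
  obtain ⟨p, -, rfl⟩ := Multiset.mem_map.1 h
  exact .inr ⟨p.1, p.2, rfl⟩

theorem add (hD : RedHad D) (hE : RedHad E) : RedHad (D + E) := fun e h =>
  (Multiset.mem_add.1 h).elim (hD e) (hE e)

theorem map_rename (hD : RedHad D) (f : ℕ → ℕ) : RedHad (D.map (rename f) : Diagram κ) :=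
  fun e h => by
    obtain ⟨e, he, rfl⟩ := Multiset.mem_map.1 h
    rcases hD e he with ⟨k, A, rfl⟩ | ⟨a, b, rfl⟩
    exacts [.inl ⟨k, A.map f, rfl⟩, .inr ⟨f a, f b, rfl⟩]

/-- By colour change each red node becomes one more variable, joined to its legs by Hadamard nodes.
-/
theorem goodT (hX : RedHad X) (hV : ∀ p ∈ X.points, p ∈ V) (hT : GraphLike V T) :
    GoodT V (X + T) := by
  induction X using Multiset.induction generalizing V T with
  | empty => exact hT.goodT.congr (zero_add T)
  | cons e X ih =>
    rw [← Multiset.singleton_add] at hX hV ⊢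
    have hX' : RedHad X := fun e he => hX e (Multiset.mem_add.2 (.inr he))
    have hV' : ∀ p ∈ Diagram.points X, p ∈ V := fun p hp => hV p (by simp [hp])
    rcases hX e (by simp) with ⟨k, A, rfl⟩ | ⟨a, b, rfl⟩
    · have hA : ∀ a ∈ A, a ∈ V := fun a ha => hV a (by simp [ha])
      obtain ⟨v, hv⟩ := Infinite.exists_notMem_finset V
      refine (GoodT.introduce (k := k) (T := X + T) hv (fun h => hv (hA _ h)) ?_ ?_).congr
        (add_assoc _ _ _)
      · rw [points_add, Multiset.mem_add, not_or]
        exact ⟨fun h => hv (hV' _ h), hT.notMem_points hv⟩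
      · have hv' := Finset.mem_insert_self v V
        refine (ih (V := insert v V) (T := {spider .green k {v}} +
          ZX.hads κ (A.map fun a => (a, v)) + T) hX'
          (fun p hp => Finset.mem_insert_of_mem (hV' p hp)) (.add (.add (.phase hv') ?_)
            (hT.mono (Finset.subset_insert v V)))).congr (by abel)
        intro e he
        simp only [ZX.hads, Multiset.map_map, Multiset.mem_map] at he
        obtain ⟨a, ha, rfl⟩ := he
        exact .inr ⟨a, Finset.mem_insert_of_mem (hA a ha), v, hv', rfl⟩
    · exact (ih hX' hV' (.add (.had (hV a (by simp)) (hV b (by simp))) hT)).congr (by abel)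

/-- A phase-free green node is inserted at a single end that meets `p`; the other ends keep their
names. -/
theorem extend (hE : RedHad E) (hP : E.points = {p} + P) (v : ℕ)
    (h : ∀ x (E' : Diagram κ), var x = v → RedHad E' → E'.points = {x} + P →
      Good (E' + {spider .green 0 ({x} + {p})} + C)) : Good (E + C) := by
  obtain ⟨e, he, hp⟩ := Multiset.mem_bind.1
    (show p ∈ E.points by rw [hP]; exact Multiset.mem_add.2 (.inl (Multiset.mem_singleton_self p)))
  obtain ⟨E, rfl⟩ := Multiset.exists_cons_of_mem he
  rw [← Multiset.singleton_add] at hE hP ⊢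
  have hE' : RedHad E := fun e he => hE e (Multiset.mem_add.2 (.inr he))
  rw [points_add, points_singleton] at hP
  have hhad (a b : ℕ) (hP : {a} + {b} + Diagram.points E = {b} + P) (h : ∀ x (E' : Diagram κ),
      var x = v → RedHad E' → E'.points = {x} + P →
        Good (E' + {spider .green 0 ({x} + {b})} + C)) :
      Good ({Element.had s(a, b)} + E + C) := by
    refine (Good.extend_had (a := a) (b := b) (C := E + C) .green v fun x hx => ?_).congr
      (by abel)
    refine (h x ({Element.had s(a, x)} + E) hx (.add (.had a x) hE') ?_).congr (by abel)
    rw [show {a} + {b} + Diagram.points E = {b} + ({a} + Diagram.points E) by abel, add_right_inj] at hP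
    simp only [points_add, points_singleton, points_had, ← hP]
    abel
  rcases hE e (by simp) with ⟨k, A, rfl⟩ | ⟨a, b, rfl⟩
  · obtain ⟨A, rfl⟩ := Multiset.exists_cons_of_mem hp
    rw [← Multiset.singleton_add] at hP ⊢
    rw [points_spider, add_assoc, add_right_inj] at hP
    refine (Good.unwire (c := .red) (k := k) (A := A) (y := p) (C := E + C) .green v
      fun x hx => ?_).congr (by abel)
    refine (h x ({spider .red k ({x} + A)} + E) hx (.add (.red k _) hE') ?_).congr (by abel)
    simp only [points_add, points_singleton, points_spider, ← hP]
    abel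
  · simp only [points_had, Multiset.mem_add, Multiset.mem_singleton] at hp
    rw [points_had] at hP
    rcases hp with rfl | rfl
    · rw [Sym2.eq_swap]
      exact hhad b p (by rwa [add_comm ({b} : Multiset ℕ)]) h
    · exact hhad a p hP h

end RedHad

theorem Good.of_isScalar (h : D.IsScalar → Good D) : Good D := fun S hS hSD => by
  refine h (fun p => ?_) S hS hSD
  have h1 := hS.isScalar p
  have h2 := hSD p
  rw [points_add, Multiset.count_add] at h2
  omega

theorem var_mem_of_mem_points_greens (h : p ∈ (greens κ V P).points) : var p ∈ V := by
  obtain ⟨e, he, hp⟩ := Multiset.mem_bind.1 h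
  obtain ⟨v, hv, rfl⟩ := Multiset.mem_map.1 he
  rw [points_spider, Multiset.mem_filter] at hp
  exact hp.2 ▸ hv

/-- Each wire whose point belongs to no variable in `V` is turned into a new variable with two legs.
The induction is on the number of ends at such points. -/
theorem RedHad.good_add_greens (hE : RedHad E) : Good (E + greens κ V E.points) := by
  induction hn : (E.points.filter fun p => var p ∉ V).card using Nat.strong_induction_on
    generalizing E V with
  | _ n ih =>
    subst hn
    by_cases hV : ∀ p ∈ E.points, var p ∈ V
    · refine (hE.map_rename var).goodT (T := 0) ?_ .zero E (add_zero _).symm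
      intro p hp
      rw [points_map_rename] at hp
      obtain ⟨q, hq, rfl⟩ := Multiset.mem_map.1 hp
      exact hV q hq
    push Not at hV
    obtain ⟨p, hp, hpV⟩ := hV
    -- Being scalar guarantees a second end at `p`, which must lie in `E`, as the green nodes have
    -- points of variables in `V` only.
    refine .of_isScalar fun hs => ?_
    have hcount := hs p
    rw [points_add, Multiset.count_add,
      Multiset.count_eq_zero.2 (fun h => hpV (var_mem_of_mem_points_greens h))] at hcount
    obtain ⟨P, hP⟩ := Multiset.exists_cons_of_mem hp
    have hp' : p ∈ P := by
      rw [← Multiset.count_pos]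
      rw [hP, Multiset.count_cons_self] at hcount
      omega
    obtain ⟨P, rfl⟩ := Multiset.exists_cons_of_mem hp'
    simp only [← Multiset.singleton_add] at hP
    obtain ⟨v, hv⟩ := Infinite.exists_notMem_finset (V ∪ (E.points.map var).toFinset)
    rw [Finset.mem_union, not_or, Multiset.mem_toFinset, Multiset.mem_map] at hv
    -- Both ends at `p` are moved to fresh points of `v`, each through a two-legged green node. The
    -- two green nodes meet at `p` and merge into the node of `v`.
    refine hE.extend hP v fun x E₁ hx hE₁ hP₁ => ?_
    refine Good.congr (D' := E₁ + ({spider .green 0 ({x} + {p})} + greens κ V E.points)) ?_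
      (by abel)
    refine hE₁.extend (p := p) (P := {x} + P) (by rw [hP₁]; abel) v fun y E₂ hy hE₂ hP₂ => ?_
    refine (Good.merge (c := .green) (j := 0) (k := 0) (A := {x}) (B := {y})
      (C := E₂ + greens κ V E.points) p ?_).congr (by ac_rfl)
    have hPv : ∀ q ∈ P, var q ≠ v := fun q hq h => hv.2 ⟨q, by rw [hP]; simp [hq], h⟩
    refine (ih _ ?_ (V := insert v V) hE₂ rfl).congr ?_
    · have h1 : (Multiset.filter (fun p => var p ∉ insert v V) P).card ≤
          (Multiset.filter (fun p => var p ∉ V) P).card :=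
        Multiset.card_le_card (Multiset.monotone_filter_right _ fun q h => by
          simp only [Finset.mem_insert, not_or] at h
          exact h.2)
      rw [hP, hP₂]
      simp only [Multiset.filter_add, Multiset.card_add, Multiset.filter_singleton, hx, hy,
        Finset.mem_insert_self, hpV]
      simp only [not_true, not_false_eq_true, if_true, if_false, Multiset.empty_eq_zero,
        Multiset.card_zero,
        Multiset.card_singleton]
      omega
    · have e : greens κ V E.points = greens κ V P := by
        rw [hP, ← add_assoc]
        exact greens_add (by simpa using hpV)
      rw [e, hP₂, ← add_assoc {y} {x} P, greens_insert_add hv.1 (by simp [hx, hy]) hPv]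
      ac_rfl

theorem RedHad.good (hE : RedHad E) : Good E :=
  (hE.good_add_greens (V := ∅)).congr (by simp [greens])

/-- The elements are moved one by one into a part made of red and Hadamard nodes. Green nodes change
colour, wires become two-legged red nodes, and stars are segments by themselves. -/
theorem good (D : Diagram κ) : Good D := by
  suffices ∀ E, RedHad E → Good (D + E) from
    (this 0 fun _ h => absurd h (Multiset.notMem_zero _)).congr (add_zero D).symm
  induction D using Multiset.induction with
  | empty => exact fun E hE => hE.good.congr (zero_add E)
  | cons e D ih =>
    intro E hE
    rw [← Multiset.singleton_add, add_assoc]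
    cases e with
    | spider c k A =>
      cases c with
      | green =>
        refine Good.colour 0 fun P _ _ => ?_
        refine (ih _ (((RedHad.red k (P.map Prod.snd)).add (.hads P)).add hE)).congr ?_
        simp only [Colour.swap]
        abel
      | red => exact (ih _ ((RedHad.red k A).add hE)).congr (by abel)
    | had s =>
      induction s with
      | _ a b => exact (ih _ ((RedHad.had a b).add hE)).congr (by abel)
    | star h => exact Good.add_node rfl (ih E hE)
    | edge s =>
      induction s with
      | _ a b =>
        refine Good.of_edge .red ?_
        exact (ih _ ((RedHad.red 0 ({a} + {b})).add hE)).congr (by abel)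

end ZX

theorem corollary1 (κ : ZX.Calculus) (D : ZX.Diagram κ) (hD : D.IsScalar) :
    ∃ D' : ZX.Diagram κ, ZX.Rewrites κ D D' ∧ D'.IsDecomposed := by
  simpa using ZX.good D 0 ⟨[], rfl, by simp, .nil⟩ (by simpa using hD)
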